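/- Let $p\ge 2$ be an integer and let $G$ be the Vilenkin group of all sequences $x=(x_j)_{j\in\mathbb Z}$ with $x_j\in\{0,\dots,p-1\}$ and $x_j=0$ for all $j<k(x)$, under coordinatewise addition $\oplus$ modulo $p$ (with inverse operation $\ominus$), with the sets $U_l=\{x: x_j=0 \text{ for } j\le l\}$, $l\in\mathbb Z$, as a basis of neighbourhoods of $0$, and with the Haar measure $\mu$ normalized by $\mu(U_0)=1$. The dual group $G^*$ consists of the same kind of sequences, with the same operation, topology and normalized Haar measure, through the pairing $\chi(x,\omega)=\exp\bigl(\frac{2\pi i}{p}\sum_{j}x_j\omega_{1-j}\bigr)$; write $U^*\subset G^*$ for the set corresponding to $U_0$. Let $A$ on $G$ and $B$ on $G^*$ be the automorphisms $(Ax)_j=x_{j+1}$, $(B\omega)_j=\omega_{j+1}$. Let $H=\{x\in G: x_j=0\text{ for } j>0\}$, let $H^\perp=\{\omega\in G^*:\chi(h,\omega)=1 \text{ for all } h\in H\}$ be its annihilator, and let $T_hf(x)=f(x\ominus h)$. For $f\in L^2(G)$ let $\hat f\in L^2(G^*)$ be its Fourier transform, the $L^2$-limit as $n\to\infty$ of $\omega\mapsto\int_{U_{-n}}f(x)\overline{\chi(x,\omega)}\,d\mu(x)$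 (which exists). A Parseval frame multiresolution analysis (Parseval FMRA) with scaling function $\phi$ is a sequence $(V_j)_{j\in\mathbb Z}$ of closed subspaces of $L^2(G)$ such that $V_j\subseteq V_{j+1}$ for all $j$; $f\in V_j$ if and only if $f(A\,\cdot)\in V_{j+1}$, for all $j$; $\overline{\bigcup_jV_j}=L^2(G)$; $\bigcap_jV_j=\{0\}$; and $\phi\in V_0$ is such that $\{T_h\phi:h\in H\}$ is a Parseval frame for $V_0$, that is, $T_h\phi\in V_0$ for all $h\in H$ and $\sum_{h\in H}|\langle f,T_h\phi\rangle|^2=\|f\|^2$ for all $f\in V_0$. **Theorem.** Let $\phi\in L^2(G)$ be a scaling function for a Parseval FMRA $(V_j)_{j\in\mathbb Z}$, and let $E_\phi=\{\omega\in G^*:\sum_{h\in H^\perp}|\hat\phi(\omega\oplus h)|^2\neq0\}$. Then (i) $\sum_{h\in H^\perp}|\hat\phi(\omega\oplus h)|^2=\mathbf 1_{E_\phi}(\omega)$ for a.e. $\omega\in G^*$; (ii) there is an $H^\perp$-periodic function $m$ on $G^*$ with $m\in L^2(U^*)$ such that $\hat\phi(B\omega)=m(\omega)\hat\phi(\omega)$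 for a.e. $\omega\in G^*$; (iii) $\lim_{j\to\infty}|\hat\phi(B^{-j}\omega)|=1$ for a.e. $\omega\in G^*$. -/

import Mathlib

open MeasureTheory Filter Topology
open scoped ENNReal ComplexConjugate

noncomputable section

/-- The sequences `(x_j)` over `ℤ` with digits modulo `p` that vanish for all `j` below some
`k = k(x)`, as a subgroup of all sequences (coordinatewise addition modulo `p`). -/
def vilenkinSubgroup (p : ℕ) : AddSubgroup (ℤ → ZMod p) where
  carrier := {x | ∃ k : ℤ, ∀ j < k, x j = 0}
  zero_mem' := ⟨0, fun _ _ => rfl⟩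
  add_mem' := by
    rintro x y ⟨k, hk⟩ ⟨l, hl⟩
    refine ⟨min k l, fun j hj => ?_⟩
    rw [Pi.add_apply, hk j (lt_of_lt_of_le hj (min_le_left _ _)),
      hl j (lt_of_lt_of_le hj (min_le_right _ _)), add_zero]
  neg_mem' := by
    rintro x ⟨k, hk⟩
    refine ⟨k, fun j hj => ?_⟩
    rw [Pi.neg_apply, hk j hj, neg_zero]

/-- The Vilenkin group. (It is not reducible to the subtype, since its topology is not the
topology of coordinatewise convergence.) The same group, with the same topology and measure,
serves as the dual group, through the pairing `VilenkinGroup.char`. -/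
def VilenkinGroup (p : ℕ) : Type := ↥(vilenkinSubgroup p)

namespace VilenkinGroup

variable {p : ℕ}

instance : AddCommGroup (VilenkinGroup p) := inferInstanceAs (AddCommGroup ↥(vilenkinSubgroup p))

instance : CoeFun (VilenkinGroup p) (fun _ => ℤ → ZMod p) := ⟨fun x => x.1⟩

theorem ext {x y : VilenkinGroup p} (h : ∀ j, x j = y j) : x = y :=
  Subtype.ext (funext h)

theorem add_apply (x y : VilenkinGroup p) (j : ℤ) : (x + y) j = x j + y j := rfl

theorem neg_apply (x : VilenkinGroup p) (j : ℤ) : (-x) j = -x j := rfl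

theorem zero_apply (j : ℤ) : (0 : VilenkinGroup p) j = 0 := rfl

/-- The basic neighbourhoods `U_l = {x | x_j = 0 for j ≤ l}` of zero. -/
def U (p : ℕ) (l : ℤ) : Set (VilenkinGroup p) := {x | ∀ j ≤ l, x j = 0}

/-- The sets `U_l`, `l ∈ ℤ`, as a basis of neighbourhoods of zero. -/
abbrev zeroBasis (p : ℕ) : AddGroupFilterBasis (VilenkinGroup p) where
  sets := Set.range (U p)
  nonempty := ⟨U p 0, 0, rfl⟩
  inter_sets := by
    rintro _ _ ⟨k, rfl⟩ ⟨l, rfl⟩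
    exact ⟨U p (max k l), ⟨_, rfl⟩, fun x hx =>
      ⟨fun j hj => hx j (hj.trans (le_max_left _ _)),
       fun j hj => hx j (hj.trans (le_max_right _ _))⟩⟩
  zero' := by
    rintro _ ⟨l, rfl⟩ j _
    rfl
  add' := by
    rintro _ ⟨l, rfl⟩
    refine ⟨U p l, ⟨l, rfl⟩, ?_⟩
    rintro _ ⟨x, hx, y, hy, rfl⟩ j hj
    change x j + y j = 0
    rw [hx j hj, hy j hj, add_zero]
  neg' := by
    rintro _ ⟨l, rfl⟩
    refine ⟨U p l, ⟨l, rfl⟩, fun x hx j hj => ?_⟩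
    change -x j = 0
    rw [hx j hj, neg_zero]
  conj' := by
    rintro x _ ⟨l, rfl⟩
    refine ⟨U p l, ⟨l, rfl⟩, fun y hy j hj => ?_⟩
    change (x + y + -x) j = 0
    rw [add_neg_cancel_comm]
    exact hy j hj

/-- The topology in which the sets `x + U_l`, `l ∈ ℤ`, form a neighbourhood basis at `x`. -/
instance : TopologicalSpace (VilenkinGroup p) := (zeroBasis p).topology

instance : IsTopologicalAddGroup (VilenkinGroup p) := (zeroBasis p).isTopologicalAddGroup

instance : MeasurableSpace (VilenkinGroup p) := borel _

instance : BorelSpace (VilenkinGroup p) := ⟨rfl⟩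

theorem U_mem_nhds_zero (l : ℤ) : U p l ∈ 𝓝 (0 : VilenkinGroup p) :=
  (zeroBasis p).mem_nhds_zero ⟨l, rfl⟩

/-- The element of `U_0` with prescribed digits at the positive places. -/
def ofDigits (a : ℕ → ZMod p) : VilenkinGroup p :=
  ⟨fun j => if 0 < j then a j.toNat else 0, 0, fun j hj => if_neg (by omega)⟩

theorem isCompact_U_zero [NeZero p] : IsCompact (U p 0) := by
  let _ : TopologicalSpace (ZMod p) := ⊥
  have : DiscreteTopology (ZMod p) := ⟨rfl⟩
  have hcont : Continuous (ofDigits : (ℕ → ZMod p) → VilenkinGroup p) := by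
    rw [continuous_iff_continuousAt]
    intro a
    have hb := (zeroBasis p).nhds_hasBasis (ofDigits a)
    rw [ContinuousAt, hb.tendsto_right_iff]
    rintro _ ⟨l, rfl⟩
    have h : ∀ᶠ b in 𝓝 a, ∀ i ∈ Finset.range (l.toNat + 1), b i = a i := by
      rw [Filter.eventually_all_finset]
      intro i _
      have hi : ContinuousAt (fun b : ℕ → ZMod p => b i) a := (continuous_apply i).continuousAt
      exact hi.eventually_mem (s := {a i}) (by simp)
    filter_upwards [h] with b hb
    refine ⟨-ofDigits a + ofDigits b, fun j hj => ?_, by simp⟩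
    change -(if 0 < j then a j.toNat else 0) + (if 0 < j then b j.toNat else 0) = 0
    split_ifs with h0
    · rw [hb j.toNat (Finset.mem_range.2 (by omega)), neg_add_cancel]
    · simp
  have himg : U p 0 = Set.range (ofDigits : (ℕ → ZMod p) → VilenkinGroup p) := by
    ext x
    constructor
    · intro hx
      refine ⟨fun n => x n, ext fun j => ?_⟩
      change (if 0 < j then x (j.toNat : ℤ) else 0) = x j
      split_ifs with h0
      · rw [Int.toNat_of_nonneg h0.le]
      · exact (hx j (by omega)).symm
    · rintro ⟨a, rfl⟩ j hj
      exact if_neg (by omega)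
  rw [himg]
  exact isCompact_range hcont

/-- The Haar measure on the Borel sets of the Vilenkin group, normalized by `μ(U) = 1`
for `U = U_0`. -/
def haar (p : ℕ) [NeZero p] : Measure (VilenkinGroup p) :=
  Measure.addHaarMeasure
    ⟨⟨U p 0, isCompact_U_zero⟩, ⟨0, mem_interior_iff_mem_nhds.2 (U_mem_nhds_zero 0)⟩⟩

instance [NeZero p] : (haar p).IsAddHaarMeasure := by
  unfold haar
  infer_instance

theorem haar_U_zero [NeZero p] : haar p (U p 0) = 1 :=
  Measure.addHaarMeasure_self

/-- The automorphism `(A x)_j = x_{j+1}`. On the dual group it is denoted `B`. -/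
def dilation (p : ℕ) : VilenkinGroup p ≃+ VilenkinGroup p where
  toFun x := ⟨fun j => x (j + 1), by
    obtain ⟨k, hk⟩ := x.2
    exact ⟨k - 1, fun j hj => hk _ (by omega)⟩⟩
  invFun x := ⟨fun j => x (j - 1), by
    obtain ⟨k, hk⟩ := x.2
    exact ⟨k + 1, fun j hj => hk _ (by omega)⟩⟩
  left_inv x := ext fun j => congrArg x.1 (by ring)
  right_inv x := ext fun j => congrArg x.1 (by ring)
  map_add' _ _ := rfl

/-- The characters `χ(x, ω) = exp ((2πi/p) ∑_j x_j ω_{1-j})`. The sum has finitely many non-zero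
terms; `ZMod.stdAddChar` is `a ↦ exp (2πi a/p)`. -/
def char [NeZero p] (x ω : VilenkinGroup p) : ℂ :=
  ZMod.stdAddChar (∑ᶠ j : ℤ, x j * ω (1 - j))

/-- The discrete subgroup `H = {x | x_j = 0 for j > 0}`. -/
def H (p : ℕ) : AddSubgroup (VilenkinGroup p) where
  carrier := {x | ∀ j > 0, x j = 0}
  zero_mem' := fun _ _ => rfl
  add_mem' := by
    intro x y hx hy j hj
    change x j + y j = 0
    rw [hx j hj, hy j hj, add_zero]
  neg_mem' := by
    intro x hx j hj
    change -x j = 0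
    rw [hx j hj, neg_zero]

/-- The annihilator of `H` in the dual group. -/
def Hperp (p : ℕ) [NeZero p] : Set (VilenkinGroup p) :=
  {ω | ∀ h ∈ H p, char h ω = 1}

theorem mem_Hperp_iff [NeZero p] (ω : VilenkinGroup p) :
    ω ∈ Hperp p ↔ ∀ j > 0, ω j = 0 := by
  constructor
  · intro hω j hj
    let e : VilenkinGroup p := ⟨Pi.single (1 - j) 1, 1 - j, fun i hi => by
      rw [Pi.single_eq_of_ne (by omega)]⟩
    have he : e ∈ H p := fun i hi => by
      change (Pi.single (1 - j) 1 : ℤ → ZMod p) i = 0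
      rw [Pi.single_eq_of_ne (by omega)]
    have h1 := hω e he
    have h2 : ∑ᶠ i : ℤ, e i * ω (1 - i) = ω j := by
      rw [finsum_eq_single _ (1 - j)]
      · change (Pi.single (1 - j) 1 : ℤ → ZMod p) (1 - j) * ω (1 - (1 - j)) = ω j
        rw [Pi.single_eq_same, one_mul, sub_sub_cancel]
      · intro i hi
        change (Pi.single (1 - j) 1 : ℤ → ZMod p) i * _ = 0
        rw [Pi.single_eq_of_ne hi, zero_mul]
    rw [char, h2] at h1
    exact ZMod.injective_stdAddChar (h1.trans (AddChar.map_zero_eq_one _).symm)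
  · intro hω h hh
    have : ∑ᶠ j : ℤ, h j * ω (1 - j) = 0 := by
      rw [← finsum_zero (α := ℤ)]
      refine finsum_congr fun j => ?_
      by_cases hj : 0 < j
      · rw [hh j hj, zero_mul]
      · rw [hω (1 - j) (by omega), mul_zero]
    rw [char, this, AddChar.map_zero_eq_one]

/-- The Hilbert space `L²` of the Vilenkin group (and of its dual). -/
abbrev L2 (p : ℕ) [NeZero p] : Type := Lp ℂ 2 (haar p)

/-- The translation operator `T_h f (x) = f (x ⊖ h)` on `L²`. -/
def translate [NeZero p] (h : VilenkinGroup p) (f : L2 p) : L2 p :=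
  Lp.compMeasurePreserving (fun x => x - h) (measurePreserving_sub_right (haar p) h) f

/-- The Fourier integral `∫ f(x) \overline{χ(x, ω)} dμ(x)`. -/
def fourierIntegral [NeZero p] (f : VilenkinGroup p → ℂ) (ω : VilenkinGroup p) : ℂ :=
  ∫ x, f x * conj (char x ω) ∂(haar p)

/-- `g` is the Fourier transform of `f ∈ L²`: the Fourier integrals of the truncations of `f` to
the compact groups `U_{-n}` (whose union is the whole group) tend to `g` in `L²` as `n → ∞`. -/
def IsFourierTransform [NeZero p] (f g : L2 p) : Prop :=
  Tendsto (fun n : ℕ =>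
      eLpNorm (fun ω => fourierIntegral ((U p (-(n : ℤ))).indicator f) ω - g ω) 2 (haar p))
    atTop (𝓝 0)

/-- The periodization `∑_{h ∈ H^⊥} |g(ω ⊕ h)|²`, as a sum in `[0, ∞]`. With `g` the Fourier
transform of `φ` this is `P_φ`. -/
def periodization [NeZero p] (g : VilenkinGroup p → ℂ) (ω : VilenkinGroup p) : ℝ≥0∞ :=
  ∑' h : Hperp p, ‖g (ω + h)‖ₑ ^ 2

/-- The set where the periodization does not vanish. With `g` the Fourier transform of `φ` this
is `E_φ`. -/
def periodizationSupport [NeZero p] (g : VilenkinGroup p → ℂ) : Set (VilenkinGroup p) :=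
  {ω | periodization g ω ≠ 0}

end VilenkinGroup

/-- The family `e` lies in the subspace `V` and is a frame for `V` with frame bounds `a`, `b`. -/
def IsFrameWithBounds {ι E : Type*} [NormedAddCommGroup E] [InnerProductSpace ℂ E]
    (V : Submodule ℂ E) (e : ι → E) (a b : ℝ) : Prop :=
  0 < a ∧ a ≤ b ∧ (∀ i, e i ∈ V) ∧ ∀ f ∈ V,
    Summable (fun i => ‖inner ℂ f (e i)‖ ^ 2) ∧
      a * ‖f‖ ^ 2 ≤ ∑' i, ‖inner ℂ f (e i)‖ ^ 2 ∧
      ∑' i, ‖inner ℂ f (e i)‖ ^ 2 ≤ b * ‖f‖ ^ 2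

/-- A Parseval frame is a frame with both bounds equal to `1`. -/
def IsParsevalFrame {ι E : Type*} [NormedAddCommGroup E] [InnerProductSpace ℂ E]
    (V : Submodule ℂ E) (e : ι → E) : Prop :=
  IsFrameWithBounds V e 1 1

namespace VilenkinGroup

/-- `V` is a frame multiresolution analysis of `L²` with scaling function `φ`. In `dilate`, the
function `g` is the class of `f(A ·)`. -/
structure IsFMRA {p : ℕ} [NeZero p] (V : ℤ → Submodule ℂ (L2 p)) (φ : L2 p) : Prop where
  closed : ∀ j, IsClosed (V j : Set (L2 p))
  mono : ∀ j, V j ≤ V (j + 1)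
  dilate : ∀ (j : ℤ) (f g : L2 p), (g =ᵐ[haar p] fun x => f (dilation p x)) →
    (f ∈ V j ↔ g ∈ V (j + 1))
  dense : closure (⋃ j, (V j : Set (L2 p))) = Set.univ
  inter : ⋂ j, (V j : Set (L2 p)) = {0}
  mem : φ ∈ V 0
  frame : ∃ a b : ℝ, IsFrameWithBounds (V 0) (fun h : H p => translate (h : VilenkinGroup p) φ) a b

/-- `V` is a Parseval FMRA with scaling function `φ`. -/
structure IsParsevalFMRA {p : ℕ} [NeZero p] (V : ℤ → Submodule ℂ (L2 p)) (φ : L2 p) : Prop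
    extends IsFMRA V φ where
  parseval : IsParsevalFrame (V 0) (fun h : H p => translate (h : VilenkinGroup p) φ)

end VilenkinGroup

end

/-! Write `Φ` for the transform of `φ` and `P` for its periodization. By Plancherel, the inner
products of `f` with the translates `T_h φ` are, up to conjugation, the Fourier coefficients on
`U_0` of the bracket `[F, Φ] = ∑ F(ω+h) conj Φ(ω+h)`, where `F` is the transform of `f`. The
Parseval frame property therefore says `∫ |[F, Φ]|² = ∫ [F, F]` over `U_0` for every `f ∈ V 0`
(`lintegral_bracket_of_mem`), and all three claims come from it.

For (i), test it on `f = φ + c T_k φ`: this gives `∫ |1 + c conj χ_k|² (P - P²) = 0` for all `c` and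
`k`. Hence every Fourier coefficient of `P - P²` vanishes, and `P` takes only the values 0 and 1
a.e. (`periodization_eq_zero_or_one`).

For (ii), since `P ∈ {0, 1}`, `[F, Φ] Φ` is the orthogonal projection of `F` onto `Φ` along each
coset of `H`. The frame identity says that no norm is lost, so `F = [F, Φ] Φ` (`ae_of_mem_V_zero`).
Apply this to the element of `V 0` with transform `Φ(B ·)`. By Cauchy–Schwarz the resulting mask is
bounded by 1 (`exists_mask`).

For (iii), `|m| ≤ 1` makes `|Φ(B⁻ʲ ω)|` nondecreasing in `j`, and (i) bounds it by 1. Density of the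
union of the `V j` lets some `V j` nearly contain the indicator of `U_0`; after `j` contractions, `V
0` nearly contains the indicator of `U_{-j}` in relative terms. Its transform is a multiple of the
indicator of `U_j`, so the frame identity forces the mean of `|Φ(B⁻ʲ ω)|²` over `U_0` to be close to
1 (`exists_one_le_lintegral_add`). The monotone limit is therefore 1.

The harmonic analysis used here is derived from completeness of the characters on `U_0`
(`ae_eq_zero_of_coeff_eq_zero`) and scaling by the dilation. -/

noncomputable section

namespace VilenkinGroup

/-! ### Cylinders, topology and the digit structure of the group -/

section Group

variable {p : ℕ}

theorem sub_apply (x y : VilenkinGroup p) (j : ℤ) : (x - y) j = x j - y j := rfl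

theorem dilation_apply (x : VilenkinGroup p) (j : ℤ) : dilation p x j = x (j + 1) := rfl

theorem mem_U_iff {x : VilenkinGroup p} {l : ℤ} : x ∈ U p l ↔ ∀ j ≤ l, x j = 0 := Iff.rfl

theorem U_anti {k l : ℤ} (h : k ≤ l) : U p l ⊆ U p k := fun _ hx j hj => hx j (hj.trans h)

theorem dilation_mem_U {x : VilenkinGroup p} {l : ℤ} :
    dilation p x ∈ U p l ↔ x ∈ U p (l + 1) := by
  constructor
  · intro h j hj
    have := h (j - 1) (by omega)
    rwa [dilation_apply, sub_add_cancel] at this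
  · intro h j hj
    exact h (j + 1) (by omega)

theorem dilation_symm_mem_U {x : VilenkinGroup p} {l : ℤ} :
    (dilation p).symm x ∈ U p (l + 1) ↔ x ∈ U p l := by
  rw [← dilation_mem_U, AddEquiv.apply_symm_apply]

theorem dilation_symm_iterate_mem_U {x : VilenkinGroup p} {l : ℤ} (n : ℕ) :
    (dilation p).symm^[n] x ∈ U p (l + n) ↔ x ∈ U p l := by
  induction n with
  | zero => simp
  | succ n ih =>
    rw [Function.iterate_succ_apply', Nat.cast_succ, ← add_assoc, dilation_symm_mem_U, ih]

theorem add_mem_U {x y : VilenkinGroup p} {l : ℤ} (hx : x ∈ U p l) (hy : y ∈ U p l) :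
    x + y ∈ U p l := fun j hj => by rw [add_apply, hx j hj, hy j hj, add_zero]

theorem neg_mem_U {x : VilenkinGroup p} {l : ℤ} (hx : x ∈ U p l) : -x ∈ U p l :=
  fun j hj => by rw [neg_apply, hx j hj, neg_zero]

theorem add_mem_U_iff {x y : VilenkinGroup p} {l : ℤ} (hy : y ∈ U p l) :
    x + y ∈ U p l ↔ x ∈ U p l :=
  ⟨fun h => by simpa using add_mem_U h (neg_mem_U hy), fun h => add_mem_U h hy⟩

theorem exists_mem_U (x : VilenkinGroup p) : ∃ n : ℕ, x ∈ U p (-(n : ℤ)) := by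
  obtain ⟨k, hk⟩ := x.2
  exact ⟨(1 - k).toNat, fun j hj => hk j (by omega)⟩

theorem exists_forall_mem_U (x : VilenkinGroup p) : ∃ n : ℕ, ∀ m ≥ n, x ∈ U p (-(m : ℤ)) := by
  obtain ⟨n, hn⟩ := exists_mem_U x
  exact ⟨n, fun m hm => U_anti (by omega) hn⟩

theorem eq_zero_of_mem_H_of_mem_U {x : VilenkinGroup p} (h : x ∈ H p) (hU : x ∈ U p 0) : x = 0 :=
  ext fun j => if hj : 0 < j then h j hj else hU j (not_lt.1 hj)

/-- The part of the sequence at the places `j ≤ 0`. -/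
def head (x : VilenkinGroup p) : VilenkinGroup p :=
  ⟨fun j => if j ≤ 0 then x j else 0, by
    obtain ⟨k, hk⟩ := x.2
    exact ⟨k, fun j hj => by simp [hk j hj]⟩⟩

theorem head_mem_H (x : VilenkinGroup p) : head x ∈ H p :=
  fun _ hj => if_neg (not_le.2 hj)

theorem sub_head_mem_U (x : VilenkinGroup p) : x - head x ∈ U p 0 := fun j hj => by
  rw [sub_apply, show head x j = x j from if_pos hj, sub_self]

/-- The finitely supported sequences as elements of the group. -/
def ofFinsupp (a : ℤ →₀ ZMod p) : VilenkinGroup p :=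
  ⟨a, by
    obtain ⟨k, hk⟩ := a.support.bddBelow
    exact ⟨k, fun j hj => Finsupp.notMem_support_iff.1 fun h => absurd (hk h) (not_le.2 hj)⟩⟩

theorem ofFinsupp_apply (a : ℤ →₀ ZMod p) (j : ℤ) : ofFinsupp a j = a j := rfl

/-- The sequences that agree with `x` up to the place `n`, i.e. the coset `x + U_n`. -/
def cyl (x : VilenkinGroup p) (n : ℤ) : Set (VilenkinGroup p) := {y | ∀ j ≤ n, y j = x j}

theorem mem_cyl_iff_sub {x y : VilenkinGroup p} {n : ℤ} : y ∈ cyl x n ↔ y - x ∈ U p n :=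
  forall₂_congr fun j _ => by rw [sub_apply, sub_eq_zero]

theorem self_mem_cyl (x : VilenkinGroup p) (n : ℤ) : x ∈ cyl x n := fun _ _ => rfl

theorem cyl_eq_of_mem {x y : VilenkinGroup p} {n : ℤ} (h : y ∈ cyl x n) : cyl y n = cyl x n :=
  Set.ext fun _ => forall₂_congr fun j hj => by rw [h j hj]

theorem cyl_anti (x : VilenkinGroup p) {m n : ℤ} (h : m ≤ n) : cyl x n ⊆ cyl x m :=
  fun _ hy j hj => hy j (hj.trans h)

theorem exists_ofFinsupp_mem_cyl (x : VilenkinGroup p) (n : ℤ) : ∃ a, ofFinsupp a ∈ cyl x n := by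
  obtain ⟨k, hk⟩ := x.2
  refine ⟨Finsupp.onFinset (Finset.Icc k n) (fun j => if j ≤ n then x j else 0) ?_, ?_⟩
  · intro j hj
    rw [Finset.mem_Icc]
    by_contra hjn
    refine hj ?_
    split_ifs with h
    · exact hk j (by omega)
    · rfl
  · intro j hj
    exact if_pos hj

theorem cyl_mem_nhds (x : VilenkinGroup p) (n : ℤ) : cyl x n ∈ 𝓝 x := by
  have h : Tendsto (fun y => y - x) (𝓝 x) (𝓝 0) := by
    have : Continuous fun y : VilenkinGroup p => y - x := continuous_id.sub continuous_const
    simpa using this.tendsto x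
  filter_upwards [h (U_mem_nhds_zero n)] with y hy
  exact mem_cyl_iff_sub.2 hy

theorem isOpen_cyl (x : VilenkinGroup p) (n : ℤ) : IsOpen (cyl x n) :=
  isOpen_iff_mem_nhds.2 fun y hy => cyl_eq_of_mem hy ▸ cyl_mem_nhds y n

theorem cyl_zero (n : ℤ) : cyl (0 : VilenkinGroup p) n = U p n := rfl

theorem isOpen_U (n : ℤ) : IsOpen (U p n) := isOpen_cyl 0 n

theorem measurableSet_U (n : ℤ) : MeasurableSet (U p n) := (isOpen_U n).measurableSet

theorem exists_cyl_subset {x : VilenkinGroup p} {s : Set (VilenkinGroup p)} (hs : s ∈ 𝓝 x) :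
    ∃ n : ℕ, cyl x n ⊆ s := by
  obtain ⟨_, ⟨l, rfl⟩, hl⟩ := ((zeroBasis p).nhds_hasBasis x).mem_iff.1 hs
  refine ⟨l.toNat, fun y hy => hl ⟨y - x, ?_, by simp⟩⟩
  exact U_anti (by omega) (mem_cyl_iff_sub.1 hy)

/-- A cylinder depends only on the digits of its centre up to `n`, so finitely supported centres
suffice. This makes the basis countable. -/
theorem isTopologicalBasis_cyl : TopologicalSpace.IsTopologicalBasis
    (Set.range fun q : (ℤ →₀ ZMod p) × ℕ => cyl (ofFinsupp q.1) q.2) := by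
  refine TopologicalSpace.isTopologicalBasis_of_isOpen_of_nhds ?_ ?_
  · rintro _ ⟨q, rfl⟩
    exact isOpen_cyl _ _
  · intro x s hx hs
    obtain ⟨n, hn⟩ := exists_cyl_subset (hs.mem_nhds hx)
    obtain ⟨a, ha⟩ := exists_ofFinsupp_mem_cyl x n
    have he := cyl_eq_of_mem ha
    exact ⟨cyl x n, ⟨(a, n), he⟩, self_mem_cyl x n, hn⟩

instance [NeZero p] : SecondCountableTopology (VilenkinGroup p) :=
  isTopologicalBasis_cyl.secondCountableTopology (Set.countable_range _)

instance [NeZero p] : Countable (H p) := by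
  refine Function.Injective.countable (β := ℤ →₀ ZMod p)
    (f := fun h => (exists_ofFinsupp_mem_cyl (h : VilenkinGroup p) 0).choose) ?_
  intro g h hgh
  have hg := (exists_ofFinsupp_mem_cyl (g : VilenkinGroup p) 0).choose_spec
  have hh := (exists_ofFinsupp_mem_cyl (h : VilenkinGroup p) 0).choose_spec
  refine Subtype.ext (ext fun j => ?_)
  rcases le_or_gt j 0 with hj | hj
  · rw [← hg j hj, ← hh j hj]
    exact congrArg (fun a => ofFinsupp a j) hgh
  · rw [g.2 j hj, h.2 j hj]

theorem continuous_of_add_mem_U {Z : Type*} [TopologicalSpace Z] {f : VilenkinGroup p → Z} (n : ℤ)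
    (h : ∀ x, ∀ u ∈ U p n, f (x + u) = f x) : Continuous f := by
  refine continuous_iff_continuousAt.2 fun x => ?_
  have : f =ᶠ[𝓝 x] fun _ => f x := by
    filter_upwards [cyl_mem_nhds x n] with y hy
    have := h x _ (mem_cyl_iff_sub.1 hy)
    rwa [add_sub_cancel] at this
  exact continuousAt_const.congr this.symm

theorem continuous_dilation : Continuous (dilation p) := by
  refine continuous_of_continuousAt_zero (dilation p) ?_
  rw [ContinuousAt, map_zero]
  refine tendsto_def.2 fun s hs => ?_
  obtain ⟨n, hn⟩ := exists_cyl_subset hs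
  filter_upwards [U_mem_nhds_zero (n + 1)] with x hx
  exact hn (dilation_mem_U.2 hx)

theorem continuous_dilation_symm : Continuous (dilation p).symm := by
  refine continuous_of_continuousAt_zero (dilation p).symm ?_
  rw [ContinuousAt, map_zero]
  refine tendsto_def.2 fun s hs => ?_
  obtain ⟨n, hn⟩ := exists_cyl_subset hs
  filter_upwards [U_mem_nhds_zero n] with x hx
  exact hn (U_anti (by omega) (dilation_symm_mem_U.2 hx))

theorem cyl_inter_U_zero (x : VilenkinGroup p) : cyl x 0 ∩ U p 0 = U p 0 ∨ cyl x 0 ∩ U p 0 = ∅ := by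
  rcases Set.eq_empty_or_nonempty (cyl x 0 ∩ U p 0) with h | ⟨y, hy, hy0⟩
  · exact Or.inr h
  · rw [← cyl_eq_of_mem hy, ← cyl_zero, cyl_eq_of_mem (x := 0) hy0, Set.inter_self]
    exact Or.inl rfl

/-- Two cylinders that meet are nested: both can be recentred at a common point. -/
theorem isPiSystem_cyl : IsPiSystem
    (Set.range fun q : (ℤ →₀ ZMod p) × ℕ => cyl (ofFinsupp q.1) q.2) := by
  rintro _ ⟨⟨a, m⟩, rfl⟩ _ ⟨⟨b, n⟩, rfl⟩ ⟨y, hya, hyb⟩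
  dsimp only at hya hyb ⊢
  rw [← cyl_eq_of_mem hya, ← cyl_eq_of_mem hyb]
  rcases le_total m n with h | h
  · rw [Set.inter_eq_right.2 (cyl_anti y (by exact_mod_cast h)), cyl_eq_of_mem hyb]
    exact ⟨(b, n), rfl⟩
  · rw [Set.inter_eq_left.2 (cyl_anti y (by exact_mod_cast h)), cyl_eq_of_mem hya]
    exact ⟨(a, m), rfl⟩

theorem borel_eq_generateFrom_cyl [NeZero p] : (inferInstance : MeasurableSpace (VilenkinGroup p)) =
    MeasurableSpace.generateFrom
      (Set.range fun q : (ℤ →₀ ZMod p) × ℕ => cyl (ofFinsupp q.1) q.2) :=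
  isTopologicalBasis_cyl.borel_eq_generateFrom

theorem finite_support_pairing (x ω : VilenkinGroup p) :
    (Function.support fun j : ℤ => x j * ω (1 - j)).Finite := by
  obtain ⟨k, hk⟩ := x.2
  obtain ⟨l, hl⟩ := ω.2
  refine (Set.finite_Icc k (1 - l)).subset fun j hj => ?_
  by_contra h
  refine hj ?_
  rw [Set.mem_Icc, not_and_or, not_le, not_le] at h
  rcases h with h | h
  · exact mul_eq_zero_of_left (hk j h) _
  · exact mul_eq_zero_of_right _ (hl (1 - j) (by omega))

theorem single_mem_H {j : ℤ} (hj : j ≤ 0) (a : ZMod p) : ofFinsupp (Finsupp.single j a) ∈ H p :=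
  fun i hi => by rw [ofFinsupp_apply, Finsupp.single_eq_of_ne (by omega)]

end Group

/-! ### Characters -/

section Char

variable {p : ℕ} [NeZero p]

/-- The substitution `j ↦ 1 - j` exchanges the two arguments, so results on one side of the duality
serve on the other. -/
theorem char_comm (x ω : VilenkinGroup p) : char x ω = char ω x := by
  unfold char
  rw [← finsum_comp_equiv (Equiv.subLeft (1 : ℤ))]
  congr 1
  refine finsum_congr fun j => ?_
  rw [Equiv.subLeft_apply, sub_sub_cancel, mul_comm]

theorem char_add_left (x y ω : VilenkinGroup p) : char (x + y) ω = char x ω * char y ω := by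
  unfold char
  rw [← AddChar.map_add_eq_mul,
    ← finsum_add_distrib (finite_support_pairing x ω) (finite_support_pairing y ω)]
  congr 1
  exact finsum_congr fun j => by rw [add_apply, add_mul]

theorem char_add_right (x ω η : VilenkinGroup p) : char x (ω + η) = char x ω * char x η := by
  rw [char_comm, char_add_left, char_comm ω, char_comm η]

theorem norm_char (x ω : VilenkinGroup p) : ‖char x ω‖ = 1 := AddChar.norm_apply _ _

theorem char_mul_conj (x ω : VilenkinGroup p) : char x ω * conj (char x ω) = 1 := by
  rw [Complex.mul_conj', norm_char]
  simp

theorem char_neg_left (x ω : VilenkinGroup p) : char (-x) ω = conj (char x ω) := by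
  unfold char
  rw [← AddChar.map_neg_eq_conj, ← finsum_neg_distrib]
  congr 1
  exact finsum_congr fun j => by rw [neg_apply, neg_mul]

/-- Each product `x_j ω_{1-j}` vanishes: either `j ≤ a`, or `1 - j ≤ -a ≤ b`. -/
theorem char_eq_one {x ω : VilenkinGroup p} {a b : ℤ} (hx : x ∈ U p a) (hω : ω ∈ U p b)
    (h : 0 ≤ a + b) : char x ω = 1 := by
  have : ∑ᶠ j : ℤ, x j * ω (1 - j) = 0 := by
    rw [← finsum_zero (α := ℤ)]
    refine finsum_congr fun j => ?_
    rcases le_or_gt j a with hj | hj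
    · rw [hx j hj, zero_mul]
    · rw [hω (1 - j) (by omega), mul_zero]
  rw [char, this, AddChar.map_zero_eq_one]

theorem char_zero_left (ω : VilenkinGroup p) : char 0 ω = 1 := by
  have := char_add_left 0 0 ω
  rw [add_zero] at this
  exact (mul_eq_left₀ (by rw [← norm_ne_zero_iff, norm_char]; exact one_ne_zero)).1 this.symm

theorem char_dilation (x ω : VilenkinGroup p) : char (dilation p x) ω = char x (dilation p ω) := by
  unfold char
  rw [← finsum_comp_equiv (Equiv.subRight (1 : ℤ))]
  congr 1
  refine finsum_congr fun j => ?_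
  rw [Equiv.subRight_apply, dilation_apply, dilation_apply, sub_add_cancel]
  exact congrArg (fun i => x j * ω i) (by ring)

theorem coe_H_eq_Hperp : (H p : Set (VilenkinGroup p)) = Hperp p :=
  Set.ext fun ω => (mem_Hperp_iff ω).symm

theorem char_eq_one_of_mem_H {h k : VilenkinGroup p} (hh : h ∈ H p) (hk : k ∈ H p) :
    char h k = 1 := ((mem_Hperp_iff k).2 hk) h hh

theorem char_add_right_of_mem_H {h k : VilenkinGroup p} (hh : h ∈ H p) (hk : k ∈ H p)
    (ω : VilenkinGroup p) : char h (ω + k) = char h ω := by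
  rw [char_add_right, char_eq_one_of_mem_H hh hk, mul_one]

theorem continuous_char_right (x : VilenkinGroup p) : Continuous (char x) := by
  obtain ⟨n, hn⟩ := exists_mem_U x
  exact continuous_of_add_mem_U n fun ω u hu => by
    rw [char_add_right, char_eq_one hn hu (by omega), mul_one]

theorem measurable_char_right (x : VilenkinGroup p) : Measurable (char x) :=
  (continuous_char_right x).measurable

theorem char_single (j : ℤ) (a : ZMod p) (ω : VilenkinGroup p) :
    char (ofFinsupp (Finsupp.single j a)) ω = ZMod.stdAddChar (a * ω (1 - j)) := by
  unfold char
  rw [finsum_eq_single _ j]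
  · rw [ofFinsupp_apply, Finsupp.single_eq_same]
  · intro i hi
    rw [ofFinsupp_apply, Finsupp.single_eq_of_ne hi, zero_mul]

theorem exists_char_ne_one {h : VilenkinGroup p} {n : ℤ} (hh : h ∉ U p (-n)) :
    ∃ ω ∈ U p n, char h ω ≠ 1 := by
  rw [mem_U_iff] at hh
  push Not at hh
  obtain ⟨j, hjn, hj⟩ := hh
  refine ⟨ofFinsupp (Finsupp.single (1 - j) 1), fun i hi => ?_, fun h1 => hj ?_⟩
  · rw [ofFinsupp_apply, Finsupp.single_eq_of_ne (by omega)]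
  · rw [char_comm, char_single, one_mul, sub_sub_cancel] at h1
    exact ZMod.injective_stdAddChar (h1.trans (AddChar.map_zero_eq_one _).symm)

/-- Orthogonality on `ZMod p`: the condition that one digit equals `b` is a linear combination of
characters. This drives the refinement step in `setIntegral_cyl_eq_zero`. -/
theorem sum_char_single (j : ℤ) (ω : VilenkinGroup p) (b : ZMod p) :
    ∑ a : ZMod p, ZMod.stdAddChar (-(a * b)) * char (ofFinsupp (Finsupp.single j a)) ω =
      if ω (1 - j) = b then (p : ℂ) else 0 := by
  have := AddChar.sum_mulShift (R := ZMod p) (ω (1 - j) - b) (ZMod.isPrimitive_stdAddChar p)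
  rw [ZMod.card] at this
  simp only [sub_eq_zero, Nat.cast_ite, Nat.cast_zero] at this
  rw [← this]
  refine Finset.sum_congr rfl fun a _ => ?_
  rw [char_single, ← AddChar.map_add_eq_mul]
  congr 1
  ring

end Char

/-! ### Haar measure, dilation and the fundamental domain of `H` -/

section Measure

variable {p : ℕ} [NeZero p]

instance : LocallyCompactSpace (VilenkinGroup p) :=
  isCompact_U_zero.locallyCompactSpace_of_mem_nhds_of_addGroup (U_mem_nhds_zero 0)

/-- The dilation as a homeomorphism. -/
def dilationHomeo (p : ℕ) : VilenkinGroup p ≃ₜ VilenkinGroup p where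
  toEquiv := (dilation p).toEquiv
  continuous_toFun := continuous_dilation
  continuous_invFun := continuous_dilation_symm

instance : (Measure.map (dilation p) (haar p)).IsAddHaarMeasure :=
  (dilation p).isAddHaarMeasure_map (haar p) continuous_dilation continuous_dilation_symm

/-- The factor by which `dilation` scales the Haar measure under push-forward. -/
def scale (p : ℕ) [NeZero p] : ℝ≥0∞ := haar p (U p 1)

theorem isCompact_U_one : IsCompact (U p 1) := by
  have : U p 1 = (dilation p).symm '' U p 0 :=
    Set.ext fun x => ⟨fun hx => ⟨dilation p x, (dilation_mem_U (l := 0)).2 hx, by simp⟩, by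
      rintro ⟨y, hy, rfl⟩
      exact (dilation_symm_mem_U (l := 0)).2 hy⟩
  rw [this]
  exact isCompact_U_zero.image continuous_dilation_symm

theorem scale_ne_zero : scale p ≠ 0 :=
  ((isOpen_U 1).measure_pos (haar p) ⟨0, fun _ _ => rfl⟩).ne'

theorem scale_ne_top : scale p ≠ ∞ := isCompact_U_one.measure_lt_top.ne

/-- By uniqueness of Haar measure the factor is the mass that the push-forward gives to `U_0`, that
is, the measure of the preimage `U_1`. Its value `1/p` plays no role; only that it is neither 0 nor
infinite. -/
theorem map_dilation : Measure.map (dilation p) (haar p) = scale p • haar p := by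
  rw [Measure.addHaarMeasure_unique (Measure.map (dilation p) (haar p))
    ⟨⟨U p 0, isCompact_U_zero⟩, ⟨0, mem_interior_iff_mem_nhds.2 (U_mem_nhds_zero 0)⟩⟩]
  congr 1
  change Measure.map (dilation p) (haar p) (U p 0) = _
  rw [Measure.map_apply continuous_dilation.measurable (measurableSet_U 0)]
  congr 1
  ext x
  exact dilation_mem_U

theorem lintegral_comp_dilation (f : VilenkinGroup p → ℝ≥0∞) :
    ∫⁻ x, f (dilation p x) ∂(haar p) = scale p * ∫⁻ x, f x ∂(haar p) := by
  rw [← smul_eq_mul, ← lintegral_smul_measure, ← map_dilation]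
  exact (lintegral_map_equiv f (dilationHomeo p).toMeasurableEquiv).symm

theorem integral_comp_dilation (f : VilenkinGroup p → ℂ) :
    ∫ x, f (dilation p x) ∂(haar p) = (scale p).toReal • ∫ x, f x ∂(haar p) := by
  rw [← integral_smul_measure, ← map_dilation]
  exact (integral_map_equiv (dilationHomeo p).toMeasurableEquiv f).symm

theorem quasiMeasurePreserving_dilation :
    Measure.QuasiMeasurePreserving (dilation p) (haar p) (haar p) :=
  ⟨continuous_dilation.measurable, by
    rw [map_dilation]
    exact Measure.smul_absolutelyContinuous⟩

theorem quasiMeasurePreserving_dilation_symm :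
    Measure.QuasiMeasurePreserving (dilation p).symm (haar p) (haar p) := by
  refine ⟨continuous_dilation_symm.measurable, ?_⟩
  have h : Measure.map (dilation p).symm (scale p • haar p) = haar p := by
    rw [← map_dilation, Measure.map_map continuous_dilation_symm.measurable
      continuous_dilation.measurable]
    convert Measure.map_id
    ext1 x
    exact (dilation p).symm_apply_apply x
  refine Measure.AbsolutelyContinuous.mk fun s hs h0 => ?_
  rw [← h, Measure.map_smul, Measure.smul_apply, smul_eq_mul, mul_eq_zero] at h0
  exact h0.resolve_left scale_ne_zero

/-- Every sequence splits uniquely into its digits at `j ≤ 0`, an element of `H`, and its digits at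
`j > 0`, an element of `U_0`. -/
theorem isAddFundamentalDomain_U_zero : IsAddFundamentalDomain (H p) (U p 0) (haar p) := by
  refine .mk' (measurableSet_U 0).nullMeasurableSet fun x => ?_
  refine ⟨-⟨head x, head_mem_H x⟩, ?_, ?_⟩
  · change -head x + x ∈ U p 0
    rw [neg_add_eq_sub]
    exact sub_head_mem_U x
  · intro h hh
    change (h : VilenkinGroup p) + x ∈ U p 0 at hh
    have h1 : (h : VilenkinGroup p) + head x ∈ U p 0 := by
      have := add_mem_U hh (neg_mem_U (sub_head_mem_U x))
      rwa [show (h : VilenkinGroup p) + x + -(x - head x) = h + head x by abel] at this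
    have h2 := eq_zero_of_mem_H_of_mem_U ((H p).add_mem h.2 (head_mem_H x)) h1
    exact Subtype.ext (eq_neg_of_add_eq_zero_left h2)

end Measure

end VilenkinGroup

/-! ### Fourier series on the compact group `U_0` -/

namespace VilenkinGroup

theorem enorm_sq_eq_lintegral {α : Type*} [MeasurableSpace α] {μ : Measure α} (F : Lp ℂ 2 μ) :
    ‖F‖ₑ ^ 2 = ∫⁻ ω, ‖F ω‖ₑ ^ 2 ∂μ := by
  rw [Lp.enorm_def, eLpNorm_eq_lintegral_rpow_enorm_toReal two_ne_zero ENNReal.ofNat_ne_top]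
  rw [← ENNReal.rpow_natCast, ← ENNReal.rpow_mul]
  simp

theorem enorm_sq_eq_tsum_of_hasSum {ι E : Type*} [NormedAddCommGroup E] {a : ι → ℂ} {x : E}
    (h : HasSum (fun i => ‖a i‖ ^ 2) (‖x‖ ^ 2)) : ∑' i, ‖a i‖ₑ ^ 2 = ‖x‖ₑ ^ 2 := by
  have := ENNReal.ofReal_tsum_of_nonneg (fun i => sq_nonneg ‖a i‖) h.summable
  rw [h.tsum_eq] at this
  simpa only [ENNReal.ofReal_pow (norm_nonneg _), ofReal_norm] using this.symm

theorem memLp_two_of_lintegral_ne_top {α : Type*} [MeasurableSpace α] {μ : Measure α} {F : α → ℂ}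
    (hm : AEStronglyMeasurable F μ) (hF : ∫⁻ ω, ‖F ω‖ₑ ^ 2 ∂μ ≠ ∞) : MemLp F 2 μ := by
  refine ⟨hm, (eLpNorm_lt_top_iff_lintegral_rpow_enorm_lt_top two_ne_zero
    ENNReal.ofNat_ne_top).2 ?_⟩
  simpa using hF.lt_top

variable {p : ℕ} [NeZero p]

/-- The normalized Haar measure of the compact group `U_0`. -/
def unitHaar (p : ℕ) [NeZero p] : Measure (VilenkinGroup p) := (haar p).restrict (U p 0)

instance : IsProbabilityMeasure (unitHaar p) :=
  ⟨by rw [unitHaar, Measure.restrict_apply_univ, haar_U_zero]⟩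

theorem ae_unitHaar_mem : ∀ᵐ ω ∂(unitHaar p), ω ∈ U p 0 := ae_restrict_mem (measurableSet_U 0)

/-- The Fourier coefficients of a function on `U_0`. -/
def coeff (F : VilenkinGroup p → ℂ) (h : VilenkinGroup p) : ℂ :=
  ∫ ω, F ω * conj (char h ω) ∂(unitHaar p)

theorem integrable_mul_char {μ : Measure (VilenkinGroup p)} {F : VilenkinGroup p → ℂ}
    (hF : Integrable F μ) (h : VilenkinGroup p) : Integrable (fun ω => F ω * char h ω) μ :=
  hF.mul_bdd (c := 1) (measurable_char_right h).aestronglyMeasurable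
    (Eventually.of_forall fun ω => (norm_char h ω).le)

theorem integrable_mul_conj_char {μ : Measure (VilenkinGroup p)} {F : VilenkinGroup p → ℂ}
    (hF : Integrable F μ) (h : VilenkinGroup p) : Integrable (fun ω => F ω * conj (char h ω)) μ := by
  simpa only [char_neg_left] using integrable_mul_char hF (-h)

/-- Translating by an `η ∈ U_n` with `χ(h, η) ≠ 1` preserves the integral and also multiplies it by
`χ(h, η)`. -/
theorem setIntegral_char_eq_zero {h : VilenkinGroup p} {n : ℤ} (hh : h ∉ U p (-n)) :
    ∫ ω in U p n, char h ω ∂(haar p) = 0 := by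
  obtain ⟨η, hη, h1⟩ := exists_char_ne_one hh
  have key : ∫ ω in U p n, char h ω ∂(haar p) =
      (∫ ω in U p n, char h ω ∂(haar p)) * char h η := by
    calc ∫ ω in U p n, char h ω ∂(haar p)
        = ∫ ω, (U p n).indicator (char h) ω ∂(haar p) := (integral_indicator (measurableSet_U n)).symm
      _ = ∫ ω, (U p n).indicator (char h) (ω + η) ∂(haar p) :=
          (integral_add_right_eq_self _ η).symm
      _ = ∫ ω, (U p n).indicator (fun ω => char h ω * char h η) ω ∂(haar p) := by
          refine integral_congr_ae (Eventually.of_forall fun ω => ?_)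
          by_cases hω : ω ∈ U p n
          · simp only [Set.indicator_of_mem hω, Set.indicator_of_mem (add_mem_U hω hη),
              char_add_right]
          · simp only [Set.indicator_of_notMem hω,
              Set.indicator_of_notMem (mt (add_mem_U_iff hη).1 hω)]
      _ = ∫ ω in U p n, char h ω * char h η ∂(haar p) := integral_indicator (measurableSet_U n)
      _ = _ := integral_mul_const _ _
  by_contra hne
  exact h1 ((mul_eq_left₀ hne).1 key.symm)

theorem integral_char_eq_zero {h : VilenkinGroup p} (hh : h ∈ H p) (h0 : h ≠ 0) :
    ∫ ω, char h ω ∂(unitHaar p) = 0 :=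
  setIntegral_char_eq_zero fun hU => h0 (eq_zero_of_mem_H_of_mem_U hh (by simpa using hU))

/-- Refining a cylinder from level `n` to `n + 1` fixes the digit `n + 1`, and that condition is a
sum of characters of elements of `H`. These are absorbed into `h`, so the induction must carry all
`h ∈ H` at once. -/
theorem setIntegral_cyl_eq_zero {F : VilenkinGroup p → ℂ} (hF : Integrable F (unitHaar p))
    (h0 : ∀ h ∈ H p, ∫ ω, F ω * char h ω ∂(unitHaar p) = 0) (n : ℕ) :
    ∀ (x : VilenkinGroup p), ∀ h ∈ H p, ∫ ω in cyl x n, F ω * char h ω ∂(unitHaar p) = 0 := by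
  induction n with
  | zero =>
    intro x h hh
    rw [unitHaar, Measure.restrict_restrict (isOpen_cyl _ _).measurableSet, Nat.cast_zero]
    rcases cyl_inter_U_zero x with he | he
    · rw [he]
      exact h0 h hh
    · rw [he, setIntegral_empty]
  | succ n ih =>
    intro x h hh
    have hp : (p : ℂ) ≠ 0 := NeZero.ne _
    refine (mul_eq_zero.1 ?_).resolve_left hp
    have hsub : cyl x (n : ℤ) ∩ cyl x ((n + 1 : ℕ) : ℤ) = cyl x ((n + 1 : ℕ) : ℤ) :=
      Set.inter_eq_right.2 (cyl_anti x (by push_cast; omega))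
    rw [← hsub, ← setIntegral_indicator (isOpen_cyl _ _).measurableSet, ← integral_const_mul]
    -- The character of a single digit at place `-n` reads off the digit of `ω` at place `n + 1`.
    have hpt : ∀ ω ∈ cyl x (n : ℤ), (p : ℂ) *
        (cyl x ((n + 1 : ℕ) : ℤ)).indicator (fun ω => F ω * char h ω) ω =
        ∑ a : ZMod p, ZMod.stdAddChar (-(a * x (n + 1))) *
          (F ω * char (h + ofFinsupp (Finsupp.single (-(n : ℤ)) a)) ω) := by
      intro ω hω
      have hs := sum_char_single (-(n : ℤ)) ω (x (n + 1))
      rw [show 1 - -(n : ℤ) = n + 1 by ring] at hs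
      have hr : ∑ a : ZMod p, ZMod.stdAddChar (-(a * x (n + 1))) *
          (F ω * char (h + ofFinsupp (Finsupp.single (-(n : ℤ)) a)) ω) =
          (F ω * char h ω) * if ω (n + 1) = x (n + 1) then (p : ℂ) else 0 := by
        rw [← hs, Finset.mul_sum]
        refine Finset.sum_congr rfl fun a _ => ?_
        rw [char_add_left]
        ring
      rw [hr]
      have hmem : ω ∈ cyl x ((n + 1 : ℕ) : ℤ) ↔ ω (n + 1) = x (n + 1) := by
        constructor
        · intro h1
          exact h1 _ (by push_cast; exact le_rfl)
        · intro h1 j hj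
          rcases lt_or_eq_of_le hj with h2 | h2
          · exact hω j (by push_cast at h2; omega)
          · push_cast at h2
            rw [h2, h1]
      by_cases hm : ω ∈ cyl x ((n + 1 : ℕ) : ℤ)
      · rw [Set.indicator_of_mem hm, if_pos (hmem.1 hm), mul_comm]
      · rw [Set.indicator_of_notMem hm, if_neg (mt hmem.2 hm), mul_zero, mul_zero]
    rw [setIntegral_congr_fun (isOpen_cyl _ _).measurableSet hpt, integral_finsetSum]
    · refine Finset.sum_eq_zero fun a _ => ?_
      rw [integral_const_mul, ih x _ ((H p).add_mem hh (single_mem_H (by omega) a)), mul_zero]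
    · intro a _
      exact ((integrable_mul_char hF _).integrableOn).const_mul _

/-- Uniqueness for integrable functions: the integrals over cylinders vanish, and cylinders form a
π-system generating the Borel sets. The `L¹` form is needed because brackets are a priori only
integrable. -/
theorem ae_eq_zero_of_coeff_eq_zero {F : VilenkinGroup p → ℂ} (hF : Integrable F (unitHaar p))
    (h0 : ∀ h ∈ H p, coeff F h = 0) : F =ᵐ[unitHaar p] 0 := by
  have h0' : ∀ h ∈ H p, ∫ ω, F ω * char h ω ∂(unitHaar p) = 0 := fun h hh => by
    have := h0 (-h) ((H p).neg_mem hh)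
    simpa only [coeff, char_neg_left, Complex.conj_conj] using this
  have hall : ∫ ω, F ω ∂(unitHaar p) = 0 := by
    simpa only [char_zero_left, mul_one] using h0' 0 (H p).zero_mem
  refine hF.ae_eq_zero_of_forall_setIntegral_eq_zero fun s hs _ => ?_
  induction s, hs using MeasurableSpace.induction_on_inter (borel_eq_generateFrom_cyl (p := p))
    isPiSystem_cyl with
  | empty => exact setIntegral_empty
  | basic t ht =>
    obtain ⟨q, rfl⟩ := ht
    simpa only [char_zero_left, mul_one] using
      setIntegral_cyl_eq_zero hF h0' q.2 (ofFinsupp q.1) 0 (H p).zero_mem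
  | compl t ht iht =>
    have := integral_add_compl ht hF
    rw [iht (measure_lt_top _ _), zero_add] at this
    rw [this, hall]
  | iUnion f hd hm ihf =>
    rw [integral_iUnion hm hd hF.integrableOn]
    exact (tsum_congr fun i => ihf i (measure_lt_top _ _)).trans tsum_zero

theorem memLp_char (h : VilenkinGroup p) : MemLp (char h) 2 (unitHaar p) :=
  MemLp.of_bound (measurable_char_right h).aestronglyMeasurable 1
    (Eventually.of_forall fun ω => (norm_char h ω).le)

theorem inner_toLp_char (h : VilenkinGroup p) (F : Lp ℂ 2 (unitHaar p)) :
    inner ℂ (memLp_char h).toLp F = coeff F h := by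
  rw [L2.inner_def]
  refine integral_congr_ae ?_
  filter_upwards [(memLp_char (p := p) h).coeFn_toLp] with ω hω
  rw [hω, RCLike.inner_apply]

theorem coeff_congr {F G : VilenkinGroup p → ℂ} (hFG : F =ᵐ[unitHaar p] G) (h : VilenkinGroup p) :
    coeff F h = coeff G h :=
  integral_congr_ae (hFG.mono fun ω hω => by simp only [hω])

theorem orthonormal_char :
    Orthonormal ℂ fun h : H p => (memLp_char (p := p) (h : VilenkinGroup p)).toLp := by
  classical
  rw [orthonormal_iff_ite]
  intro g h
  rw [inner_toLp_char, coeff_congr (memLp_char (p := p) h).coeFn_toLp, coeff]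
  split_ifs with hgh
  · subst hgh
    simp only [char_mul_conj]
    simp
  · rw [← integral_char_eq_zero ((H p).sub_mem h.2 g.2)
      (sub_ne_zero.2 fun he => hgh (Subtype.ext he.symm))]
    refine integral_congr_ae (Eventually.of_forall fun ω => ?_)
    simp only [sub_eq_add_neg, char_add_left, char_neg_left]

/-- The characters form an orthonormal basis of `L²` of the compact group `U_0`. -/
def charBasis (p : ℕ) [NeZero p] : HilbertBasis (H p) ℂ (Lp ℂ 2 (unitHaar p)) :=
  HilbertBasis.mkOfOrthogonalEqBot orthonormal_char (by
    rw [Submodule.eq_bot_iff]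
    intro F hF
    rw [Submodule.mem_orthogonal] at hF
    refine (Lp.eq_zero_iff_ae_eq_zero).2 (ae_eq_zero_of_coeff_eq_zero
      ((Lp.memLp F).integrable one_le_two) fun h hh => ?_)
    rw [← inner_toLp_char]
    exact hF _ (Submodule.subset_span ⟨⟨h, hh⟩, rfl⟩))

theorem charBasis_repr (F : Lp ℂ 2 (unitHaar p)) (h : H p) :
    (charBasis p).repr F h = coeff F h := by
  rw [HilbertBasis.repr_apply_apply, charBasis, HilbertBasis.coe_mkOfOrthogonalEqBot,
    inner_toLp_char]

theorem tsum_enorm_coeff_Lp (F : Lp ℂ 2 (unitHaar p)) :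
    ∑' h : H p, ‖coeff F h‖ₑ ^ 2 = ∫⁻ ω, ‖F ω‖ₑ ^ 2 ∂(unitHaar p) := by
  rw [← enorm_sq_eq_lintegral]
  refine enorm_sq_eq_tsum_of_hasSum ?_
  have h := lp.hasSum_norm (p := 2) (by norm_num) ((charBasis p).repr F)
  simpa [charBasis_repr] using h

theorem tsum_enorm_coeff_of_memLp {F : VilenkinGroup p → ℂ} (hF : MemLp F 2 (unitHaar p)) :
    ∑' h : H p, ‖coeff F h‖ₑ ^ 2 = ∫⁻ ω, ‖F ω‖ₑ ^ 2 ∂(unitHaar p) := by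
  have := tsum_enorm_coeff_Lp hF.toLp
  simp only [coeff_congr hF.coeFn_toLp] at this
  rw [this]
  exact lintegral_congr_ae (hF.coeFn_toLp.mono fun ω hω => by simp only [hω])

/-- Parseval's identity on `U_0`, for integrable functions. Both sides may be infinite. -/
theorem tsum_enorm_coeff {F : VilenkinGroup p → ℂ} (hF : Integrable F (unitHaar p)) :
    ∑' h : H p, ‖coeff F h‖ₑ ^ 2 = ∫⁻ ω, ‖F ω‖ₑ ^ 2 ∂(unitHaar p) := by
  by_cases hfin : ∑' h : H p, ‖coeff F h‖ₑ ^ 2 = ∞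
  · by_contra hne
    rw [hfin] at hne
    exact hne (hfin.symm.trans
      (tsum_enorm_coeff_of_memLp (memLp_two_of_lintegral_ne_top hF.1 (Ne.symm hne))))
  -- Riesz–Fischer: square-summable coefficients come from some `G ∈ L²`, and uniqueness in `L¹`
  -- identifies `F` with `G`.
  have hmem : Memℓp (fun h : H p => coeff F h) 2 := by
    refine memℓp_gen ?_
    have h1 : Summable fun h : H p => (‖coeff F h‖ₑ ^ 2).toReal := ENNReal.summable_toReal hfin
    simpa using h1
  set G : Lp ℂ 2 (unitHaar p) := (charBasis p).repr.symm ⟨_, hmem⟩ with hG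
  have hGint : Integrable G (unitHaar p) := (Lp.memLp G).integrable one_le_two
  have hcoeff : ∀ h ∈ H p, coeff (fun ω => F ω - G ω) h = 0 := by
    intro h hh
    have h1 : coeff G h = coeff F h := by
      rw [← charBasis_repr G ⟨h, hh⟩, hG, LinearIsometryEquiv.apply_symm_apply]
    rw [coeff]
    simp only [sub_mul]
    rw [integral_sub (integrable_mul_conj_char hF h) (integrable_mul_conj_char hGint h)]
    exact sub_eq_zero.2 h1.symm
  have hae : F =ᵐ[unitHaar p] G := by
    filter_upwards [ae_eq_zero_of_coeff_eq_zero (hF.sub hGint) hcoeff] with ω hω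
    exact sub_eq_zero.1 hω
  exact tsum_enorm_coeff_of_memLp ((memLp_congr_ae hae).2 (Lp.memLp G))

end VilenkinGroup

/-! ### Plancherel's theorem and the Fourier transform on `L²` -/

namespace VilenkinGroup

variable {p : ℕ}

/-- The truncation of a function to `U_{-n}`. -/
def trunc (n : ℕ) (f : VilenkinGroup p → ℂ) : VilenkinGroup p → ℂ :=
  (U p (-(n : ℤ))).indicator f

theorem trunc_of_mem {n : ℕ} {x : VilenkinGroup p} (hx : x ∈ U p (-(n : ℤ)))
    (f : VilenkinGroup p → ℂ) : trunc n f x = f x := Set.indicator_of_mem hx f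

theorem trunc_of_notMem {n : ℕ} {x : VilenkinGroup p} (hx : x ∉ U p (-(n : ℤ)))
    (f : VilenkinGroup p → ℂ) : trunc n f x = 0 := Set.indicator_of_notMem hx f

variable [NeZero p]

theorem lintegral_eq_lintegral_tsum {f : VilenkinGroup p → ℝ≥0∞} (hf : Measurable f) :
    ∫⁻ ω, f ω ∂(haar p) = ∫⁻ ω, ∑' h : H p, f (ω + h) ∂(unitHaar p) := by
  rw [isAddFundamentalDomain_U_zero.lintegral_eq_tsum'', lintegral_tsum]
  · refine tsum_congr fun h => lintegral_congr fun ω => ?_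
    rw [add_comm]
    rfl
  · exact fun h => (hf.comp (measurable_add_const _)).aemeasurable

theorem fourierIntegral_congr {f g : VilenkinGroup p → ℂ} (h : f =ᵐ[haar p] g)
    (ω : VilenkinGroup p) : fourierIntegral f ω = fourierIntegral g ω :=
  integral_congr_ae (h.mono fun x hx => by simp only [hx])

theorem integrable_mul_conj_char_left {f : VilenkinGroup p → ℂ} (hf : Integrable f (haar p))
    (ω : VilenkinGroup p) : Integrable (fun x => f x * conj (char x ω)) (haar p) := by
  simpa only [char_comm ω] using integrable_mul_conj_char hf ω

theorem fourierIntegral_add {f g : VilenkinGroup p → ℂ} (hf : Integrable f (haar p))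
    (hg : Integrable g (haar p)) (ω : VilenkinGroup p) :
    fourierIntegral (fun x => f x + g x) ω = fourierIntegral f ω + fourierIntegral g ω := by
  simp only [fourierIntegral, add_mul]
  exact integral_add (integrable_mul_conj_char_left hf ω) (integrable_mul_conj_char_left hg ω)

theorem fourierIntegral_const_mul (c : ℂ) (f : VilenkinGroup p → ℂ) (ω : VilenkinGroup p) :
    fourierIntegral (fun x => c * f x) ω = c * fourierIntegral f ω := by
  simp only [fourierIntegral, mul_assoc]
  exact integral_const_mul _ _

theorem fourierIntegral_add_of_mem {f : VilenkinGroup p → ℂ} {n : ℤ}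
    (hf : ∀ x ∉ U p (-n), f x = 0) (ω : VilenkinGroup p) {u : VilenkinGroup p} (hu : u ∈ U p n) :
    fourierIntegral f (ω + u) = fourierIntegral f ω := by
  refine integral_congr_ae (Eventually.of_forall fun x => ?_)
  by_cases hx : x ∈ U p (-n)
  · simp only [char_add_right, char_eq_one hx hu (by omega), mul_one]
  · simp only [hf x hx, zero_mul]

theorem continuous_fourierIntegral {f : VilenkinGroup p → ℂ} {n : ℤ}
    (hf : ∀ x ∉ U p (-n), f x = 0) : Continuous (fourierIntegral f) :=
  continuous_of_add_mem_U n fun ω _ hu => fourierIntegral_add_of_mem hf ω hu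

theorem fourierIntegral_comp_dilation (f : VilenkinGroup p → ℂ) (ω : VilenkinGroup p) :
    fourierIntegral (fun x => f (dilation p x)) (dilation p ω) =
      (scale p).toReal • fourierIntegral f ω := by
  rw [fourierIntegral, fourierIntegral, ← integral_comp_dilation]
  simp only [char_dilation]

theorem enorm_scale_smul (z : ℂ) : ‖(scale p).toReal • z‖ₑ = scale p * ‖z‖ₑ := by
  rw [enorm_smul, Real.enorm_of_nonneg ENNReal.toReal_nonneg, ENNReal.ofReal_toReal scale_ne_top]

/-- The transform of a function supported in `U_0` is constant on cosets of `U_0`, and its values on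
`H` are the Fourier coefficients. Plancherel thus reduces to Parseval on `U_0`. -/
theorem lintegral_fourierIntegral_unit {f : VilenkinGroup p → ℂ} (hf : MemLp f 2 (haar p))
    (hs : ∀ x ∉ U p 0, f x = 0) :
    ∫⁻ ω, ‖fourierIntegral f ω‖ₑ ^ 2 ∂(haar p) = ∫⁻ x, ‖f x‖ₑ ^ 2 ∂(haar p) := by
  have hc : Continuous (fourierIntegral f) := continuous_fourierIntegral (n := 0) (by simpa using hs)
  have hcoeff : ∀ h, fourierIntegral f h = coeff f h := by
    intro h
    rw [coeff, unitHaar, setIntegral_eq_integral_of_forall_compl_eq_zero]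
    · simp only [fourierIntegral, char_comm h]
    · intro x hx
      rw [hs x hx, zero_mul]
  have hconst : ∀ᵐ ω ∂(unitHaar p), ∑' h : H p, ‖fourierIntegral f (ω + h)‖ₑ ^ 2 =
      ∑' h : H p, ‖coeff f h‖ₑ ^ 2 := by
    filter_upwards [ae_unitHaar_mem] with ω hω
    refine tsum_congr fun h => ?_
    rw [add_comm, fourierIntegral_add_of_mem (n := 0) (by simpa using hs) _ hω, hcoeff]
  rw [lintegral_eq_lintegral_tsum (hc.measurable.enorm.pow_const 2), lintegral_congr_ae hconst,
    lintegral_const, measure_univ, mul_one, tsum_enorm_coeff_of_memLp (hf.restrict _), unitHaar,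
    ← lintegral_indicator (measurableSet_U 0)]
  refine lintegral_congr fun x => ?_
  by_cases hx : x ∈ U p 0
  · rw [Set.indicator_of_mem hx]
  · rw [Set.indicator_of_notMem hx, hs x hx]
    simp

theorem lintegral_enorm_sq_ne_top {α : Type*} [MeasurableSpace α] {μ : Measure α} {f : α → ℂ}
    (hf : MemLp f 2 μ) : ∫⁻ x, ‖f x‖ₑ ^ 2 ∂μ ≠ ∞ := by
  have := (eLpNorm_lt_top_iff_lintegral_rpow_enorm_lt_top two_ne_zero ENNReal.ofNat_ne_top).1 hf.2
  simpa using this.ne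

theorem memLp_comp_dilation {f : VilenkinGroup p → ℂ} (hf : MemLp f 2 (haar p)) :
    MemLp (fun x => f (dilation p x)) 2 (haar p) := by
  refine memLp_two_of_lintegral_ne_top
    (hf.1.comp_quasiMeasurePreserving quasiMeasurePreserving_dilation) ?_
  rw [lintegral_comp_dilation fun x => ‖f x‖ₑ ^ 2]
  exact ENNReal.mul_ne_top scale_ne_top (lintegral_enorm_sq_ne_top hf)

/-- Plancherel's identity for compactly supported functions. -/
theorem lintegral_fourierIntegral (n : ℕ) : ∀ {f : VilenkinGroup p → ℂ}, MemLp f 2 (haar p) →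
    (∀ x ∉ U p (-(n : ℤ)), f x = 0) →
    ∫⁻ ω, ‖fourierIntegral f ω‖ₑ ^ 2 ∂(haar p) = ∫⁻ x, ‖f x‖ₑ ^ 2 ∂(haar p) := by
  induction n with
  | zero => exact fun hf hs => lintegral_fourierIntegral_unit hf (by simpa using hs)
  | succ n ih =>
    intro f hf hs
    -- Composing with the dilation shrinks the support from `U_{-(n+1)}` to `U_{-n}`. Both sides of
    -- the identity acquire the factor `scale p ^ 2`, which cancels.
    have hg := memLp_comp_dilation hf
    have h := ih hg fun x hx => hs _ fun hx' => hx <| by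
      rw [dilation_mem_U] at hx'
      simpa using hx'
    have h2 := lintegral_comp_dilation (p := p)
      fun ω => ‖fourierIntegral (fun x => f (dilation p x)) ω‖ₑ ^ 2
    rw [h, lintegral_comp_dilation fun x => ‖f x‖ₑ ^ 2] at h2
    simp only [fourierIntegral_comp_dilation, enorm_scale_smul, mul_pow] at h2
    rw [lintegral_const_mul' _ _ (ENNReal.pow_ne_top scale_ne_top), ← mul_assoc, ← sq] at h2
    exact (ENNReal.mul_right_inj (pow_ne_zero 2 scale_ne_zero)
      (ENNReal.pow_ne_top scale_ne_top)).1 h2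

theorem memLp_trunc (n : ℕ) {f : VilenkinGroup p → ℂ} (hf : MemLp f 2 (haar p)) :
    MemLp (trunc n f) 2 (haar p) := hf.indicator (measurableSet_U _)

theorem haar_U_neg_lt_top (n : ℕ) : haar p (U p (-(n : ℤ))) < ∞ := by
  induction n with
  | zero =>
    rw [Nat.cast_zero, neg_zero, haar_U_zero]
    exact ENNReal.one_lt_top
  | succ n ih =>
    have h := congrArg (fun μ => μ (U p (-((n + 1 : ℕ) : ℤ)))) (map_dilation (p := p))
    have he : dilation p ⁻¹' U p (-((n + 1 : ℕ) : ℤ)) = U p (-(n : ℤ)) := by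
      ext x
      rw [Set.mem_preimage, dilation_mem_U]
      simp
    simp only [Measure.map_apply continuous_dilation.measurable (measurableSet_U _),
      Measure.smul_apply, smul_eq_mul, he] at h
    rw [h] at ih
    exact ENNReal.lt_top_of_mul_ne_top_right ih.ne scale_ne_zero

theorem integrable_trunc (n : ℕ) {f : VilenkinGroup p → ℂ} (hf : MemLp f 2 (haar p)) :
    Integrable (trunc n f) (haar p) := by
  rw [trunc, integrable_indicator_iff (measurableSet_U _)]
  have : IsFiniteMeasure ((haar p).restrict (U p (-(n : ℤ)))) :=
    ⟨by rw [Measure.restrict_apply_univ]; exact haar_U_neg_lt_top n⟩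
  exact (hf.restrict _).integrable one_le_two

theorem memLp_fourierIntegral_trunc (n : ℕ) {f : VilenkinGroup p → ℂ} (hf : MemLp f 2 (haar p)) :
    MemLp (fourierIntegral (trunc n f)) 2 (haar p) := by
  have hs : ∀ x ∉ U p (-(n : ℤ)), trunc n f x = 0 := fun x hx => trunc_of_notMem hx f
  refine memLp_two_of_lintegral_ne_top
    (continuous_fourierIntegral hs).measurable.aestronglyMeasurable ?_
  rw [lintegral_fourierIntegral n (memLp_trunc n hf) hs]
  exact lintegral_enorm_sq_ne_top (memLp_trunc n hf)

theorem trunc_congr (n : ℕ) {f g : VilenkinGroup p → ℂ} (h : f =ᵐ[haar p] g) :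
    trunc n f =ᵐ[haar p] trunc n g :=
  h.mono fun x hx => by simp only [trunc, Set.indicator, hx]

/-- The Fourier integral of the truncation to `U_{-n}`, as a linear map of `L²`. -/
def truncFourier (p : ℕ) [NeZero p] (n : ℕ) : L2 p →ₗ[ℂ] L2 p where
  toFun f := (memLp_fourierIntegral_trunc n (Lp.memLp f)).toLp
  map_add' f g := by
    rw [← MemLp.toLp_add]
    refine MemLp.toLp_congr _ _ (Eventually.of_forall fun ω => ?_)
    rw [Pi.add_apply, ← fourierIntegral_add (integrable_trunc n (Lp.memLp f))
      (integrable_trunc n (Lp.memLp g))]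
    refine fourierIntegral_congr ((trunc_congr n (Lp.coeFn_add f g)).trans
      (Eventually.of_forall fun x => ?_)) ω
    exact congrFun (Set.indicator_add _ f g) x
  map_smul' c f := by
    rw [RingHom.id_apply, ← MemLp.toLp_const_smul]
    refine MemLp.toLp_congr _ _ (Eventually.of_forall fun ω => ?_)
    rw [Pi.smul_apply, smul_eq_mul, ← fourierIntegral_const_mul]
    refine fourierIntegral_congr ((trunc_congr n (Lp.coeFn_smul c f)).trans
      (Eventually.of_forall fun x => ?_)) ω
    exact congrFun (Set.indicator_const_smul _ c f) x

/-- Truncation to `U_{-n}` on `L²`. -/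
def truncLp (n : ℕ) (f : L2 p) : L2 p := (memLp_trunc n (Lp.memLp f)).toLp

theorem coeFn_truncLp (n : ℕ) (f : L2 p) : truncLp n f =ᵐ[haar p] trunc n f :=
  (memLp_trunc n (Lp.memLp f)).coeFn_toLp

theorem coeFn_truncFourier (n : ℕ) (f : L2 p) :
    truncFourier p n f =ᵐ[haar p] fourierIntegral (trunc n f) :=
  (memLp_fourierIntegral_trunc n (Lp.memLp f)).coeFn_toLp

theorem enorm_truncFourier_sq (n : ℕ) (f : L2 p) :
    ‖truncFourier p n f‖ₑ ^ 2 = ∫⁻ x, ‖trunc n f x‖ₑ ^ 2 ∂(haar p) := by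
  rw [enorm_sq_eq_lintegral,
    ← lintegral_fourierIntegral n (memLp_trunc n (Lp.memLp f)) fun x hx => trunc_of_notMem hx f]
  exact lintegral_congr_ae ((coeFn_truncFourier n f).mono fun ω hω => by simp only [hω])

theorem enorm_truncLp_sq (n : ℕ) (f : L2 p) :
    ‖truncLp n f‖ₑ ^ 2 = ∫⁻ x, ‖trunc n f x‖ₑ ^ 2 ∂(haar p) := by
  rw [enorm_sq_eq_lintegral]
  exact lintegral_congr_ae ((coeFn_truncLp n f).mono fun ω hω => by simp only [hω])

theorem norm_truncFourier (n : ℕ) (f : L2 p) : ‖truncFourier p n f‖ = ‖truncLp n f‖ := by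
  have h := (enorm_truncFourier_sq n f).trans (enorm_truncLp_sq n f).symm
  have h' := congrArg ENNReal.toReal h
  simpa [ENNReal.toReal_pow] using h'

theorem norm_truncLp_le (n : ℕ) (f : L2 p) : ‖truncLp n f‖ ≤ ‖f‖ := by
  refine Lp.norm_le_norm_of_ae_le ?_
  filter_upwards [coeFn_truncLp n f] with x hx
  rw [hx]
  exact norm_indicator_le_norm_self _ _

theorem truncFourier_truncLp {m n : ℕ} (h : n ≤ m) (f : L2 p) :
    truncFourier p m (truncLp n f) = truncFourier p n f := by
  refine (MemLp.toLp_eq_toLp_iff (memLp_fourierIntegral_trunc m (Lp.memLp _))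
    (memLp_fourierIntegral_trunc n (Lp.memLp f))).2 (Eventually.of_forall fun ω => ?_)
  refine fourierIntegral_congr ((trunc_congr m (coeFn_truncLp n f)).trans
    (Eventually.of_forall fun x => ?_)) ω
  simp only [trunc, Set.indicator_indicator]
  rw [Set.inter_eq_right.2 (U_anti (by omega))]

theorem tendsto_truncLp (f : L2 p) : Tendsto (fun n => truncLp n f) atTop (𝓝 f) := by
  have hlim : Tendsto (fun n => ∫⁻ x, ‖trunc n f x - f x‖ₑ ^ 2 ∂(haar p)) atTop (𝓝 0) := by
    rw [← lintegral_zero (μ := haar p)]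
    refine tendsto_lintegral_of_dominated_convergence' (fun x => ‖f x‖ₑ ^ 2) (fun n => ?_)
      (fun n => Eventually.of_forall fun x => ?_) (lintegral_enorm_sq_ne_top (Lp.memLp f))
      (Eventually.of_forall fun x => ?_)
    · exact ((memLp_trunc n (Lp.memLp f)).1.sub (Lp.memLp f).1).enorm.pow_const 2
    · by_cases hx : x ∈ U p (-(n : ℤ))
      · simp [trunc_of_mem hx]
      · simp [trunc_of_notMem hx]
    · obtain ⟨n, hn⟩ := exists_forall_mem_U x
      refine tendsto_const_nhds.congr' ?_
      filter_upwards [eventually_ge_atTop n] with m hm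
      simp [trunc_of_mem (hn m hm)]
  rw [tendsto_iff_norm_sub_tendsto_zero]
  have hsq : ∀ n, ‖truncLp n f - f‖ ^ 2 = (∫⁻ x, ‖trunc n f x - f x‖ₑ ^ 2 ∂(haar p)).toReal := by
    intro n
    have h1 : ∫⁻ x, ‖trunc n f x - f x‖ₑ ^ 2 ∂(haar p) = ‖truncLp n f - f‖ₑ ^ 2 := by
      rw [enorm_sq_eq_lintegral]
      refine lintegral_congr_ae ?_
      filter_upwards [Lp.coeFn_sub (truncLp n f) f, coeFn_truncLp n f] with x h1 h2
      rw [h1, Pi.sub_apply, h2]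
    rw [h1, ENNReal.toReal_pow, toReal_enorm]
  have h2 : Tendsto (fun n => ‖truncLp n f - f‖ ^ 2) atTop (𝓝 0) := by
    simp only [hsq]
    exact (ENNReal.tendsto_toReal ENNReal.zero_ne_top).comp hlim
  have h3 := h2.sqrt
  simpa using h3

theorem isFourierTransform_iff (f g : L2 p) :
    IsFourierTransform f g ↔ Tendsto (fun n => truncFourier p n f) atTop (𝓝 g) := by
  rw [Lp.tendsto_Lp_iff_tendsto_eLpNorm', IsFourierTransform]
  refine tendsto_congr fun n => eLpNorm_congr_ae ?_
  filter_upwards [coeFn_truncFourier n f] with ω hω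
  rw [Pi.sub_apply, hω]
  rfl

/-- For `n ≤ m` the difference of the truncated transforms is the `m`-th transform of `f - truncLp n
f`, up to sign, so the sequence is Cauchy by Plancherel for compact support. -/
theorem exists_isFourierTransform (f : L2 p) : ∃ g, IsFourierTransform f g := by
  simp only [isFourierTransform_iff]
  refine cauchySeq_tendsto_of_complete (cauchySeq_of_le_tendsto_0' (fun n => ‖f - truncLp n f‖)
    (fun n m hnm => ?_) ?_)
  · rw [dist_comm, dist_eq_norm, ← truncFourier_truncLp hnm, ← map_sub, norm_truncFourier]
    exact norm_truncLp_le _ _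
  · simpa using (tendsto_const_nhds (x := f)).sub (tendsto_truncLp f) |>.norm

theorem IsFourierTransform.unique {f g g' : L2 p} (h : IsFourierTransform f g)
    (h' : IsFourierTransform f g') : g = g' :=
  tendsto_nhds_unique ((isFourierTransform_iff _ _).1 h) ((isFourierTransform_iff _ _).1 h')

/-- The Fourier transform on `L²`. -/
def fourier (p : ℕ) [NeZero p] : L2 p →ₗᵢ[ℂ] L2 p where
  toFun f := (exists_isFourierTransform f).choose
  map_add' f g := by
    refine (exists_isFourierTransform (f + g)).choose_spec.unique ?_
    rw [isFourierTransform_iff]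
    simp only [map_add]
    exact ((isFourierTransform_iff _ _).1 (exists_isFourierTransform f).choose_spec).add
      ((isFourierTransform_iff _ _).1 (exists_isFourierTransform g).choose_spec)
  map_smul' c f := by
    refine (exists_isFourierTransform (c • f)).choose_spec.unique ?_
    rw [isFourierTransform_iff]
    simp only [map_smul]
    exact ((isFourierTransform_iff _ _).1 (exists_isFourierTransform f).choose_spec).const_smul c
  norm_map' f := by
    have h1 := ((isFourierTransform_iff _ _).1 (exists_isFourierTransform f).choose_spec).norm
    simp only [norm_truncFourier] at h1
    exact tendsto_nhds_unique h1 (tendsto_truncLp f).norm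

theorem isFourierTransform_fourier (f : L2 p) : IsFourierTransform f (fourier p f) :=
  (exists_isFourierTransform f).choose_spec

theorem coeFn_translate (h : VilenkinGroup p) (f : L2 p) :
    translate h f =ᵐ[haar p] fun x => f (x - h) :=
  Lp.coeFn_compMeasurePreserving f (measurePreserving_sub_right (haar p) h)

theorem fourierIntegral_comp_sub (f : VilenkinGroup p → ℂ) (h ω : VilenkinGroup p) :
    fourierIntegral (fun x => f (x - h)) ω = conj (char h ω) * fourierIntegral f ω := by
  rw [fourierIntegral, ← integral_add_right_eq_self _ h, fourierIntegral, ← integral_const_mul]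
  refine integral_congr_ae (Eventually.of_forall fun x => ?_)
  simp only [add_sub_cancel_right, char_add_left, map_mul]
  ring

theorem fourier_translate (h : VilenkinGroup p) (f : L2 p) :
    fourier p (translate h f) =ᵐ[haar p] fun ω => conj (char h ω) * fourier p f ω := by
  have hmem : MemLp (fun ω => conj (char h ω) * fourier p f ω) 2 (haar p) := by
    refine (Lp.memLp (fourier p f)).of_le (g := fourier p f) ?_ (Eventually.of_forall fun ω => ?_)
    · refine AEStronglyMeasurable.mul ?_ (Lp.memLp _).1
      simp only [← char_neg_left]
      exact (measurable_char_right (-h)).aestronglyMeasurable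
    · rw [norm_mul, RCLike.norm_conj, norm_char, one_mul]
  have hFT : IsFourierTransform (translate h f) hmem.toLp := by
    refine Tendsto.congr' ?_ (isFourierTransform_fourier f)
    -- As soon as `h` lies in the subgroup `U_{-m}`, truncation to it commutes with translation by
    -- `h`, and the modulation identity holds exactly.
    obtain ⟨n, hn⟩ := exists_forall_mem_U h
    filter_upwards [eventually_ge_atTop n] with m hm
    have hI : ∀ ω, fourierIntegral ((U p (-(m : ℤ))).indicator (translate h f)) ω =
        conj (char h ω) * fourierIntegral ((U p (-(m : ℤ))).indicator f) ω := by
      intro ω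
      rw [← fourierIntegral_comp_sub]
      refine fourierIntegral_congr ((trunc_congr m (coeFn_translate h f)).trans
        (Eventually.of_forall fun x => ?_)) ω
      have hiff : x - h ∈ U p (-(m : ℤ)) ↔ x ∈ U p (-(m : ℤ)) := by
        rw [sub_eq_add_neg, add_mem_U_iff (neg_mem_U (hn m hm))]
      by_cases hx : x ∈ U p (-(m : ℤ))
      · simp only [trunc, Set.indicator_of_mem hx, Set.indicator_of_mem (hiff.2 hx)]
      · simp only [trunc, Set.indicator_of_notMem hx, Set.indicator_of_notMem (mt hiff.1 hx)]
    refine eLpNorm_congr_norm_ae ?_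
    filter_upwards [hmem.coeFn_toLp] with ω hω
    rw [hω, hI, ← mul_sub, norm_mul, RCLike.norm_conj, norm_char, one_mul]
  rw [(isFourierTransform_fourier _).unique hFT]
  exact hmem.coeFn_toLp

theorem eLpNorm_comp_dilation (f : VilenkinGroup p → ℂ) :
    eLpNorm (fun x => f (dilation p x)) 2 (haar p) =
      scale p ^ (1 / (2 : ℝ)) * eLpNorm f 2 (haar p) := by
  have h := (dilationHomeo p).toMeasurableEquiv.measurableEmbedding.eLpNorm_map_measure
    (μ := haar p) (g := f) (p := 2)
  have hm : Measure.map (dilationHomeo p).toMeasurableEquiv (haar p) = scale p • haar p :=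
    map_dilation
  rw [hm, eLpNorm_smul_measure_of_ne_top ENNReal.ofNat_ne_top] at h
  refine h.symm.trans ?_
  simp

theorem fourier_comp_dilation {f g : L2 p} (hg : g =ᵐ[haar p] fun x => f (dilation p x)) :
    (fun ω => fourier p g (dilation p ω)) =ᵐ[haar p]
      fun ω => (scale p).toReal • fourier p f ω := by
  have hc : (scale p).toReal ≠ 0 := ENNReal.toReal_ne_zero.2 ⟨scale_ne_zero, scale_ne_top⟩
  set G : VilenkinGroup p → ℂ := ⇑(fourier p g)
  have hmem : MemLp (fun ω => ((scale p).toReal)⁻¹ • G (dilation p ω)) 2 (haar p) :=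
    (memLp_comp_dilation (Lp.memLp (fourier p g))).const_smul ((scale p).toReal)⁻¹
  have hFT : IsFourierTransform f hmem.toLp := by
    -- The index shifts by one: `g` cut off to `U_{-n}` is `f` cut off to `U_{-(n+1)}`, composed
    -- with the dilation.
    refine (tendsto_add_atTop_iff_nat 1).1 ?_
    have h0 := isFourierTransform_fourier g
    have h1 := ENNReal.Tendsto.const_mul (a := ‖((scale p).toReal)⁻¹‖ₑ * scale p ^ (1 / (2 : ℝ))) h0
      (Or.inr (ENNReal.mul_ne_top enorm_ne_top
        (ENNReal.rpow_ne_top_of_nonneg (by norm_num) scale_ne_top)))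
    rw [mul_zero] at h1
    refine h1.congr fun n => ?_
    rw [mul_assoc, ← eLpNorm_comp_dilation, ← eLpNorm_const_smul]
    refine eLpNorm_congr_ae ?_
    filter_upwards [hmem.coeFn_toLp] with ω hω
    have hI : fourierIntegral ((U p (-(n : ℤ))).indicator g) (dilation p ω) =
        (scale p).toReal • fourierIntegral ((U p (-((n + 1 : ℕ) : ℤ))).indicator f) ω := by
      rw [← fourierIntegral_comp_dilation]
      refine fourierIntegral_congr ((trunc_congr n hg).trans (Eventually.of_forall fun x => ?_)) _
      have hiff : dilation p x ∈ U p (-((n + 1 : ℕ) : ℤ)) ↔ x ∈ U p (-(n : ℤ)) := by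
        rw [dilation_mem_U]
        simp
      by_cases hx : x ∈ U p (-(n : ℤ))
      · simp only [trunc, Set.indicator_of_mem hx, Set.indicator_of_mem (hiff.2 hx)]
      · simp only [trunc, Set.indicator_of_notMem hx, Set.indicator_of_notMem (mt hiff.1 hx)]
    rw [hω, Pi.smul_apply, hI, smul_sub, smul_smul, inv_mul_cancel₀ hc, one_smul]
  rw [(isFourierTransform_fourier f).unique hFT]
  filter_upwards [hmem.coeFn_toLp] with ω hω
  rw [hω, smul_smul, mul_inv_cancel₀ hc, one_smul]

/-- The indicator function of `U_{-n}` as an element of `L²`. -/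
def indicatorU (p : ℕ) [NeZero p] (n : ℕ) : L2 p :=
  indicatorConstLp 2 (measurableSet_U (-(n : ℤ))) (haar_U_neg_lt_top n).ne 1

theorem coeFn_indicatorU (n : ℕ) :
    indicatorU p n =ᵐ[haar p] (U p (-(n : ℤ))).indicator fun _ => 1 := indicatorConstLp_coeFn

/-- A character is 1 on `U_n` when `ω ∈ U_{-n}` and integrates to 0 over `U_n` otherwise. -/
theorem fourierIntegral_indicator (n : ℤ) (ω : VilenkinGroup p) :
    fourierIntegral ((U p n).indicator fun _ => 1) ω =
      (U p (-n)).indicator (fun _ => ((haar p).real (U p n) : ℂ)) ω := by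
  have h1 : fourierIntegral ((U p n).indicator fun _ => 1) ω =
      ∫ x in U p n, char (-ω) x ∂(haar p) := by
    rw [fourierIntegral, ← integral_indicator (measurableSet_U n)]
    refine integral_congr_ae (Eventually.of_forall fun x => ?_)
    by_cases hx : x ∈ U p n
    · simp only [Set.indicator_of_mem hx, one_mul, char_neg_left, char_comm ω]
    · simp only [Set.indicator_of_notMem hx, zero_mul]
  rw [h1]
  by_cases hω : ω ∈ U p (-n)
  · rw [Set.indicator_of_mem hω, setIntegral_congr_fun (g := fun _ => 1) (measurableSet_U n)]
    · simp
    · exact fun x hx => char_eq_one (neg_mem_U hω) hx (by omega)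
  · rw [Set.indicator_of_notMem hω]
    exact setIntegral_char_eq_zero fun h => hω (by simpa using neg_mem_U h)

theorem fourier_indicatorU (n : ℕ) : fourier p (indicatorU p n) =ᵐ[haar p]
    (U p n).indicator fun _ => ((haar p).real (U p (-(n : ℤ))) : ℂ) := by
  have hT : Tendsto (fun m => truncFourier p m (indicatorU p n)) atTop
      (𝓝 (truncFourier p n (indicatorU p n))) := by
    refine tendsto_const_nhds.congr' ?_
    filter_upwards [eventually_ge_atTop n] with m hm
    rw [← truncFourier_truncLp hm]
    congr 1
    refine Lp.ext ?_
    filter_upwards [coeFn_truncLp n (indicatorU p n), coeFn_indicatorU (p := p) n] with x h1 h2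
    rw [h1]
    by_cases hx : x ∈ U p (-(n : ℤ))
    · exact trunc_of_mem hx _
    · rw [trunc_of_notMem hx, h2, Set.indicator_of_notMem hx]
  rw [(isFourierTransform_fourier (indicatorU p n)).unique ((isFourierTransform_iff _ _).2 hT)]
  filter_upwards [coeFn_truncFourier n (indicatorU p n)] with ω hω
  rw [hω, fourierIntegral_congr (trunc_congr n (coeFn_indicatorU n)), trunc,
    Set.indicator_indicator, Set.inter_self, fourierIntegral_indicator, neg_neg]

end VilenkinGroup

/-! ### The bracket product and the analysis operator -/

namespace VilenkinGroup

section Sequences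

variable {ι : Type*} {a b : ι → ℂ}

theorem memℓp_two_of_tsum_ne_top (ha : ∑' i, ‖a i‖ₑ ^ 2 ≠ ∞) : Memℓp a 2 := by
  refine memℓp_gen ?_
  have h1 : Summable fun i => (‖a i‖ₑ ^ 2).toReal := ENNReal.summable_toReal ha
  simpa using h1

theorem tsum_enorm_sq_lp (f : lp (fun _ : ι => ℂ) 2) : ∑' i, ‖f i‖ₑ ^ 2 = ‖f‖ₑ ^ 2 := by
  refine enorm_sq_eq_tsum_of_hasSum ?_
  simpa using lp.hasSum_norm (p := 2) (by norm_num) f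

theorem summable_mul_conj (ha : ∑' i, ‖a i‖ₑ ^ 2 ≠ ∞) (hb : ∑' i, ‖b i‖ₑ ^ 2 ≠ ∞) :
    Summable fun i => a i * conj (b i) := by
  have := lp.summable_inner (𝕜 := ℂ) (⟨b, memℓp_two_of_tsum_ne_top hb⟩ : lp (fun _ : ι => ℂ) 2)
    ⟨a, memℓp_two_of_tsum_ne_top ha⟩
  simpa only [RCLike.inner_apply] using this

theorem enorm_tsum_mul_conj_sq_le (ha : ∑' i, ‖a i‖ₑ ^ 2 ≠ ∞) (hb : ∑' i, ‖b i‖ₑ ^ 2 ≠ ∞) :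
    ‖∑' i, a i * conj (b i)‖ₑ ^ 2 ≤ (∑' i, ‖a i‖ₑ ^ 2) * ∑' i, ‖b i‖ₑ ^ 2 := by
  let A : lp (fun _ : ι => ℂ) 2 := ⟨a, memℓp_two_of_tsum_ne_top ha⟩
  let B : lp (fun _ : ι => ℂ) 2 := ⟨b, memℓp_two_of_tsum_ne_top hb⟩
  have hin : inner ℂ B A = ∑' i, a i * conj (b i) := lp.inner_eq_tsum B A
  have h : ‖(inner ℂ B A : ℂ)‖ₑ ≤ ‖B‖ₑ * ‖A‖ₑ := by
    simp only [← ofReal_norm]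
    rw [← ENNReal.ofReal_mul (norm_nonneg _)]
    exact ENNReal.ofReal_le_ofReal (norm_inner_le_norm B A)
  rw [hin] at h
  calc _ ≤ (‖B‖ₑ * ‖A‖ₑ) ^ 2 := by gcongr
    _ = _ := by rw [mul_pow, ← tsum_enorm_sq_lp A, ← tsum_enorm_sq_lp B, mul_comm]

/-- Pythagoras: when `‖b‖` is 0 or 1, `⟨b, a⟩ b` is the orthogonal projection of `a` onto the span
of `b`. -/
theorem tsum_enorm_sub_sq_add (ha : ∑' i, ‖a i‖ₑ ^ 2 ≠ ∞)
    (hb : ∑' i, ‖b i‖ₑ ^ 2 = 0 ∨ ∑' i, ‖b i‖ₑ ^ 2 = 1) :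
    ∑' i, ‖a i - (∑' j, a j * conj (b j)) * b i‖ₑ ^ 2 + ‖∑' j, a j * conj (b j)‖ₑ ^ 2 =
      ∑' i, ‖a i‖ₑ ^ 2 := by
  have hb' : ∑' i, ‖b i‖ₑ ^ 2 ≠ ∞ := by rcases hb with h | h <;> simp [h]
  let A : lp (fun _ : ι => ℂ) 2 := ⟨a, memℓp_two_of_tsum_ne_top ha⟩
  let B : lp (fun _ : ι => ℂ) 2 := ⟨b, memℓp_two_of_tsum_ne_top hb'⟩
  have hin : inner ℂ B A = ∑' i, a i * conj (b i) := lp.inner_eq_tsum B A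
  rw [← hin]
  have hB : ‖B‖ₑ ^ 2 = 0 ∨ ‖B‖ₑ ^ 2 = 1 := by rwa [← tsum_enorm_sq_lp B]
  have hreal : ‖A - inner ℂ B A • B‖ ^ 2 + ‖(inner ℂ B A : ℂ)‖ ^ 2 = ‖A‖ ^ 2 := by
    rcases hB with h | h
    · have : B = 0 := by simpa using h
      simp [this]
    · have h1 : ‖B‖ ^ 2 = 1 := by simpa using congrArg ENNReal.toReal h
      rw [@norm_sub_sq ℂ, inner_smul_right, norm_smul, mul_pow, h1, ← inner_conj_symm A B,
        RCLike.mul_conj]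
      norm_cast
      ring
  have hA : ∑' i, ‖a i‖ₑ ^ 2 = ‖A‖ₑ ^ 2 := tsum_enorm_sq_lp A
  have hAB : ∑' i, ‖a i - inner ℂ B A * b i‖ₑ ^ 2 = ‖A - inner ℂ B A • B‖ₑ ^ 2 :=
    tsum_enorm_sq_lp (A - inner ℂ B A • B)
  rw [hA, hAB]
  simp only [← ofReal_norm, ← ENNReal.ofReal_pow (norm_nonneg _)]
  rw [← ENNReal.ofReal_add (sq_nonneg _) (sq_nonneg _), hreal]

end Sequences

variable {p : ℕ}

theorem tsum_add_H {α : Type*} [AddCommMonoid α] [TopologicalSpace α] (f : VilenkinGroup p → α)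
    (ω : VilenkinGroup p) (h : H p) : ∑' k : H p, f (ω + h + k) = ∑' k : H p, f (ω + k) := by
  rw [← (Equiv.addLeft h).tsum_eq fun k : H p => f (ω + k)]
  refine tsum_congr fun k => congrArg f ?_
  rw [add_assoc]
  rfl

/-- The bracket product `∑_{h ∈ H^⊥} F(ω ⊕ h) \overline{G(ω ⊕ h)}`. -/
def bracket (F G : VilenkinGroup p → ℂ) (ω : VilenkinGroup p) : ℂ :=
  ∑' h : H p, F (ω + h) * conj (G (ω + h))

theorem bracket_add (F G : VilenkinGroup p → ℂ) (ω : VilenkinGroup p) (h : H p) :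
    bracket F G (ω + h) = bracket F G ω :=
  tsum_add_H (fun ω => F ω * conj (G ω)) ω h

variable [NeZero p]

theorem periodization_eq (g : VilenkinGroup p → ℂ) (ω : VilenkinGroup p) :
    periodization g ω = ∑' h : H p, ‖g (ω + h)‖ₑ ^ 2 :=
  ((Equiv.setCongr coe_H_eq_Hperp).tsum_eq fun h : Hperp p => ‖g (ω + h)‖ₑ ^ 2).symm

theorem periodization_add (g : VilenkinGroup p → ℂ) (ω : VilenkinGroup p) (h : H p) :
    periodization g (ω + h) = periodization g ω := by
  simp only [periodization_eq]
  exact tsum_add_H (fun ω => ‖g ω‖ₑ ^ 2) ω h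

theorem quasiMeasurePreserving_add_right (h : VilenkinGroup p) :
    Measure.QuasiMeasurePreserving (fun ω => ω + h) (haar p) (haar p) :=
  (measurePreserving_add_right (haar p) h).quasiMeasurePreserving

theorem ae_forall_add {Q : VilenkinGroup p → Prop} (hQ : ∀ᵐ ω ∂(haar p), Q ω) :
    ∀ᵐ ω ∂(haar p), ∀ h : H p, Q (ω + h) :=
  ae_all_iff.2 fun h => (quasiMeasurePreserving_add_right (h : VilenkinGroup p)).ae hQ

theorem ae_unitHaar_of_ae {Q : VilenkinGroup p → Prop} (hQ : ∀ᵐ ω ∂(haar p), Q ω) :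
    ∀ᵐ ω ∂(unitHaar p), Q ω := ae_restrict_of_ae hQ

/-- The exceptional set is `H`-invariant and null in a fundamental domain of the countable group
`H`. -/
theorem ae_of_ae_unitHaar {Q : VilenkinGroup p → Prop}
    (hper : ∀ ω, ∀ h : H p, Q ω → Q (ω + h)) (hQ : ∀ᵐ ω ∂(unitHaar p), Q ω) :
    ∀ᵐ ω ∂(haar p), Q ω := by
  refine isAddFundamentalDomain_U_zero.measure_zero_of_invariant {ω | ¬ Q ω} (fun h => ?_) ?_
  · ext ω
    rw [Set.mem_vadd_set_iff_neg_vadd_mem]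
    change ¬ Q (((-h : H p) : VilenkinGroup p) + ω) ↔ ¬ Q ω
    refine not_congr ⟨fun hq => ?_, fun hq => ?_⟩
    · have := hper _ h hq
      rwa [add_comm, AddSubgroup.coe_neg, add_neg_cancel_left] at this
    · rw [add_comm]
      exact hper _ _ hq
  · rw [ae_iff, unitHaar, Measure.restrict_apply₀' (measurableSet_U 0).nullMeasurableSet] at hQ
    exact hQ

theorem measurable_coe_L2 (F : L2 p) : Measurable F := (Lp.stronglyMeasurable F).measurable

theorem measurable_periodization {g : VilenkinGroup p → ℂ} (hg : Measurable g) :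
    Measurable (periodization g) := by
  simp only [funext (periodization_eq g)]
  exact Measurable.tsum fun h => (hg.comp (measurable_add_const _)).enorm.pow_const 2

theorem lintegral_periodization (F : L2 p) :
    ∫⁻ ω, periodization F ω ∂(unitHaar p) = ‖F‖ₑ ^ 2 := by
  rw [enorm_sq_eq_lintegral, lintegral_eq_lintegral_tsum ((measurable_coe_L2 F).enorm.pow_const 2)]
  simp only [periodization_eq]

theorem periodization_ne_top_unit (F : L2 p) : ∀ᵐ ω ∂(unitHaar p), periodization F ω ≠ ∞ := by
  refine (ae_lt_top (measurable_periodization (measurable_coe_L2 F)) ?_).mono fun ω h => h.ne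
  rw [lintegral_periodization]
  exact ENNReal.pow_ne_top enorm_ne_top

theorem hasSum_bracket (F G : L2 p) : ∀ᵐ ω ∂(unitHaar p),
    HasSum (fun h : H p => F (ω + h) * conj (G (ω + h))) (bracket F G ω) := by
  filter_upwards [periodization_ne_top_unit F, periodization_ne_top_unit G] with ω hF hG
  rw [periodization_eq] at hF hG
  exact (summable_mul_conj hF hG).hasSum

theorem measurable_mul_conj (F G : L2 p) : Measurable fun ω => F ω * conj (G ω) :=
  (measurable_coe_L2 F).mul (Complex.continuous_conj.measurable.comp (measurable_coe_L2 G))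

theorem aestronglyMeasurable_bracket (F G : L2 p) :
    AEStronglyMeasurable (bracket F G) (unitHaar p) := by
  refine aestronglyMeasurable_of_tendsto_ae (u := (atTop : Filter (Finset (H p))))
    (f := fun s ω => ∑ h ∈ s, F (ω + h) * conj (G (ω + h))) (fun s => ?_) (hasSum_bracket F G)
  exact (Finset.measurable_sum s fun h _ =>
    (measurable_mul_conj F G).comp (measurable_add_const _)).aestronglyMeasurable

theorem integrable_mul_conj (F G : L2 p) : Integrable (fun ω => F ω * conj (G ω)) (haar p) := by
  simpa only [RCLike.inner_apply] using L2.integrable_inner (𝕜 := ℂ) G F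

theorem tsum_lintegral_mul_conj_ne_top (F G : L2 p) :
    ∫⁻ ω, ∑' h : H p, ‖F (ω + h) * conj (G (ω + h))‖ₑ ∂(unitHaar p) ≠ ∞ := by
  rw [← lintegral_eq_lintegral_tsum (measurable_mul_conj F G).enorm]
  exact (integrable_mul_conj F G).2.ne

theorem integrable_bracket (F G : L2 p) : Integrable (bracket F G) (unitHaar p) := by
  refine ⟨aestronglyMeasurable_bracket F G, lt_of_le_of_lt (lintegral_mono_ae ?_)
    (tsum_lintegral_mul_conj_ne_top F G).lt_top⟩
  filter_upwards [hasSum_bracket F G] with ω hω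
  exact enorm_tsum_le_tsum_enorm

theorem integral_eq_integral_tsum {f : VilenkinGroup p → ℂ} (hf : Measurable f)
    (hi : Integrable f (haar p)) :
    ∫ ω, f ω ∂(haar p) = ∫ ω, ∑' h : H p, f (ω + h) ∂(unitHaar p) := by
  rw [isAddFundamentalDomain_U_zero.integral_eq_tsum'' f hi, integral_tsum]
  · refine tsum_congr fun h => integral_congr_ae (Eventually.of_forall fun ω => ?_)
    dsimp only
    rw [add_comm]
    rfl
  · exact fun h => (hf.comp (measurable_add_const _)).aestronglyMeasurable
  · have hm : ∀ h : H p, AEMeasurable (fun ω => ‖f (ω + h)‖ₑ) (unitHaar p) := fun h =>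
      (hf.comp (measurable_add_const _)).enorm.aemeasurable
    rw [← lintegral_tsum hm, ← lintegral_eq_lintegral_tsum hf.enorm]
    exact hi.2.ne

/-- Plancherel turns the translate into a modulation. Folding the integral onto `U_0` gives the
bracket, because `χ(h, ·)` with `h ∈ H` is itself `H`-periodic. -/
theorem inner_translate (φ f : L2 p) (h : H p) :
    inner ℂ (translate (h : VilenkinGroup p) φ) f =
      coeff (bracket (fourier p f) (fourier p φ)) (-h : H p) := by
  rw [← (fourier p).inner_map_map, L2.inner_def]
  have h1 : ∫ ω, inner ℂ (fourier p (translate (h : VilenkinGroup p) φ) ω) (fourier p f ω) ∂(haar p)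
      = ∫ ω, fourier p f ω * conj (fourier p φ ω) * char h ω ∂(haar p) := by
    refine integral_congr_ae ?_
    filter_upwards [fourier_translate (h : VilenkinGroup p) φ] with ω hω
    rw [hω, RCLike.inner_apply, map_mul, Complex.conj_conj]
    ring
  rw [h1, integral_eq_integral_tsum
    (f := fun ω => fourier p f ω * conj (fourier p φ ω) * char h ω)
    ((measurable_mul_conj _ _).mul (measurable_char_right _)) (integrable_mul_char (integrable_mul_conj _ _) _), coeff]
  refine integral_congr_ae (Eventually.of_forall fun ω => ?_)
  simp only [AddSubgroup.coe_neg, char_neg_left, Complex.conj_conj, bracket, ← tsum_mul_right]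
  exact tsum_congr fun k => by rw [char_add_right_of_mem_H h.2 k.2]

/-- The analysis operator of the system `T_h φ`, expressed through the bracket product. -/
theorem tsum_enorm_inner_translate (φ f : L2 p) :
    ∑' h : H p, ‖inner ℂ f (translate (h : VilenkinGroup p) φ)‖ₑ ^ 2 =
      ∫⁻ ω, ‖bracket (fourier p f) (fourier p φ) ω‖ₑ ^ 2 ∂(unitHaar p) := by
  rw [← tsum_enorm_coeff (integrable_bracket _ _), ← (Equiv.neg (H p)).tsum_eq]
  refine tsum_congr fun h => ?_
  rw [Equiv.neg_apply, ← inner_conj_symm, RCLike.enorm_conj, inner_translate, neg_neg]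

end VilenkinGroup

/-! ### The periodization and the mask -/

namespace VilenkinGroup

variable {p : ℕ} [NeZero p] {V : ℤ → Submodule ℂ (L2 p)} {φ : L2 p}

theorem tsum_enorm_inner_of_mem (hV : IsParsevalFMRA V φ) {f : L2 p} (hf : f ∈ V 0) :
    ∑' h : H p, ‖inner ℂ f (translate (h : VilenkinGroup p) φ)‖ₑ ^ 2 = ‖f‖ₑ ^ 2 := by
  obtain ⟨-, -, -, h⟩ := hV.parseval
  obtain ⟨h1, h2, h3⟩ := h f hf
  rw [one_mul] at h2 h3
  refine enorm_sq_eq_tsum_of_hasSum ?_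
  rw [← le_antisymm h3 h2]
  exact h1.hasSum

theorem translate_mem (hV : IsParsevalFMRA V φ) (h : H p) :
    translate (h : VilenkinGroup p) φ ∈ V 0 := hV.parseval.2.2.1 h

theorem lintegral_bracket_of_mem (hV : IsParsevalFMRA V φ) {f : L2 p} (hf : f ∈ V 0) :
    ∫⁻ ω, ‖bracket (fourier p f) (fourier p φ) ω‖ₑ ^ 2 ∂(unitHaar p) =
      ∫⁻ ω, periodization (fourier p f) ω ∂(unitHaar p) := by
  rw [← tsum_enorm_inner_translate, tsum_enorm_inner_of_mem hV hf, lintegral_periodization,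
    ← ofReal_norm, ← ofReal_norm, LinearIsometry.norm_map]

theorem _root_.ENNReal.le_one_of_sq_le_one {a : ℝ≥0∞} (h : a ^ 2 ≤ 1) : a ≤ 1 := by
  by_contra! h1
  refine absurd h (not_le.2 ?_)
  rw [sq]
  exact one_mul (1 : ℝ≥0∞) ▸ ENNReal.mul_lt_mul h1 h1

theorem bracket_self (F : VilenkinGroup p → ℂ) (ω : VilenkinGroup p) :
    bracket F F ω = ((periodization F ω).toReal : ℂ) := by
  rw [periodization_eq, ENNReal.tsum_toReal_eq, bracket, Complex.ofReal_tsum]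
  · refine tsum_congr fun h => ?_
    rw [Complex.mul_conj', ENNReal.toReal_pow, toReal_enorm, Complex.ofReal_pow]
  · exact fun h => ENNReal.pow_ne_top enorm_ne_top

theorem integrable_toReal_periodization (F : L2 p) :
    Integrable (fun ω => (periodization F ω).toReal) (unitHaar p) := by
  refine integrable_toReal_of_lintegral_ne_top
    (measurable_periodization (measurable_coe_L2 F)).aemeasurable ?_
  rw [lintegral_periodization]
  exact ENNReal.pow_ne_top enorm_ne_top

/-- This is the frame identity for `φ + c T_k φ`, whose transform is `φ̂` times an `H`-periodic
factor; the factor comes out of both the bracket and the periodization. -/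
theorem lintegral_enorm_mul_periodization (hV : IsParsevalFMRA V φ) (c : ℂ) (k : H p) :
    ∫⁻ ω, ‖1 + c * conj (char (k : VilenkinGroup p) ω)‖ₑ ^ 2 *
        periodization (fourier p φ) ω ^ 2 ∂(unitHaar p) =
      ∫⁻ ω, ‖1 + c * conj (char (k : VilenkinGroup p) ω)‖ₑ ^ 2 *
        periodization (fourier p φ) ω ∂(unitHaar p) := by
  have hf : φ + c • translate (k : VilenkinGroup p) φ ∈ V 0 :=
    (V 0).add_mem hV.mem ((V 0).smul_mem c (translate_mem hV k))
  have hF : fourier p (φ + c • translate (k : VilenkinGroup p) φ) =ᵐ[haar p]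
      fun ω => (1 + c * conj (char (k : VilenkinGroup p) ω)) * fourier p φ ω := by
    rw [map_add, map_smul]
    filter_upwards [Lp.coeFn_add (fourier p φ) (c • fourier p (translate (k : VilenkinGroup p) φ)),
      Lp.coeFn_smul c (fourier p (translate (k : VilenkinGroup p) φ)),
      fourier_translate (k : VilenkinGroup p) φ] with ω h1 h2 h3
    rw [h1, Pi.add_apply, h2, Pi.smul_apply, h3, smul_eq_mul]
    ring
  have hF' := ae_unitHaar_of_ae (ae_forall_add hF)
  have h := lintegral_bracket_of_mem hV hf
  convert h using 1
  · refine lintegral_congr_ae ?_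
    filter_upwards [hF', periodization_ne_top_unit (fourier p φ)] with ω h1 h2
    have hb : bracket (fourier p (φ + c • translate (k : VilenkinGroup p) φ)) (fourier p φ) ω =
        (1 + c * conj (char (k : VilenkinGroup p) ω)) *
          ((periodization (fourier p φ) ω).toReal : ℂ) := by
      rw [← bracket_self, bracket, bracket, ← tsum_mul_left]
      refine tsum_congr fun h => ?_
      rw [h1, char_add_right_of_mem_H k.2 h.2, mul_assoc]
    rw [hb, enorm_mul, mul_pow, ← ofReal_norm (((periodization _ ω).toReal : ℝ) : ℂ),
      Complex.norm_real, Real.norm_of_nonneg ENNReal.toReal_nonneg, ENNReal.ofReal_toReal h2]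
  · refine lintegral_congr_ae ?_
    filter_upwards [hF'] with ω h1
    rw [periodization_eq, periodization_eq, ← ENNReal.tsum_mul_left]
    refine tsum_congr fun h => ?_
    rw [h1, char_add_right_of_mem_H k.2 h.2, enorm_mul, mul_pow]

theorem integrable_toReal_periodization_sq (hV : IsParsevalFMRA V φ) :
    Integrable (fun ω => (periodization (fourier p φ) ω).toReal ^ 2) (unitHaar p) := by
  -- With `c = 0` the identity reads `∫ P² = ∫ P`, which is finite.
  have h := lintegral_enorm_mul_periodization hV 0 0
  simp only [zero_mul, add_zero, enorm_one, one_pow, one_mul, lintegral_periodization] at h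
  have h1 := integrable_toReal_of_lintegral_ne_top
    ((measurable_periodization (measurable_coe_L2 (fourier p φ))).pow_const 2).aemeasurable
    (h ▸ ENNReal.pow_ne_top enorm_ne_top)
  simpa only [ENNReal.toReal_pow] using h1

theorem integral_norm_sq_mul_sub (hV : IsParsevalFMRA V φ) (c : ℂ) (k : H p) :
    ∫ ω, ‖1 + c * conj (char (k : VilenkinGroup p) ω)‖ ^ 2 *
      ((periodization (fourier p φ) ω).toReal - (periodization (fourier p φ) ω).toReal ^ 2)
      ∂(unitHaar p) = 0 := by
  have hmeas : Measurable fun ω => 1 + c * conj (char (k : VilenkinGroup p) ω) := by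
    simp only [← char_neg_left]
    exact measurable_const.add (measurable_const.mul (measurable_char_right _))
  have hP := measurable_periodization (measurable_coe_L2 (fourier p φ))
  have hbd : ∀ᵐ ω ∂(unitHaar p), ‖‖1 + c * conj (char (k : VilenkinGroup p) ω)‖ ^ 2‖ ≤
      (1 + ‖c‖) ^ 2 := Eventually.of_forall fun ω => by
    rw [norm_pow, norm_norm]
    gcongr
    refine (norm_add_le _ _).trans ?_
    rw [norm_one, norm_mul, RCLike.norm_conj, norm_char, mul_one]
  simp only [mul_sub]
  rw [integral_sub, sub_eq_zero]
  · have h := congrArg ENNReal.toReal (lintegral_enorm_mul_periodization hV c k)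
    have hint : ∀ g : VilenkinGroup p → ℝ≥0∞, Measurable g → (∀ᵐ ω ∂(unitHaar p), g ω ≠ ∞) →
        (∫⁻ ω, ‖1 + c * conj (char (k : VilenkinGroup p) ω)‖ₑ ^ 2 * g ω ∂(unitHaar p)).toReal =
        ∫ ω, ‖1 + c * conj (char (k : VilenkinGroup p) ω)‖ ^ 2 * (g ω).toReal ∂(unitHaar p) := by
      intro g hg hfin
      rw [← integral_toReal]
      · simp
      · exact ((hmeas.enorm.pow_const 2).mul hg).aemeasurable
      · filter_upwards [hfin] with ω hω
        exact ENNReal.mul_lt_top (ENNReal.pow_lt_top enorm_lt_top) hω.lt_top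
    rw [hint _ hP (periodization_ne_top_unit _), hint _ (hP.pow_const 2)
      ((periodization_ne_top_unit (fourier p φ)).mono fun ω hω => ENNReal.pow_ne_top hω)] at h
    simpa only [ENNReal.toReal_pow] using h.symm
  · exact (integrable_toReal_periodization _).bdd_mul (c := (1 + ‖c‖) ^ 2)
      (hmeas.norm.pow_const 2).aestronglyMeasurable hbd
  · exact (integrable_toReal_periodization_sq hV).bdd_mul (c := (1 + ‖c‖) ^ 2)
      (hmeas.norm.pow_const 2).aestronglyMeasurable hbd

/-- The periodization of the Fourier transform of the scaling function is a characteristic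
function. -/
theorem periodization_eq_zero_or_one (hV : IsParsevalFMRA V φ) : ∀ᵐ ω ∂(haar p),
    periodization (fourier p φ) ω = 0 ∨ periodization (fourier p φ) ω = 1 := by
  refine ae_of_ae_unitHaar (fun ω h => by rw [periodization_add]; exact id) ?_
  set D : VilenkinGroup p → ℝ := fun ω => (periodization (fourier p φ) ω).toReal -
    (periodization (fourier p φ) ω).toReal ^ 2 with hD
  have hDi : Integrable D (unitHaar p) :=
    (integrable_toReal_periodization _).sub (integrable_toReal_periodization_sq hV)
  have hD0 : ∫ ω, D ω ∂(unitHaar p) = 0 := by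
    simpa using integral_norm_sq_mul_sub hV 0 0
  have hcoeff : ∀ k ∈ H p, coeff (fun ω => (D ω : ℂ)) k = 0 := by
    intro k hk
    set z := coeff (fun ω => (D ω : ℂ)) k
    -- Taking `c = conj z` turns the cross term into `2‖z‖²`; the remaining terms are multiples of
    -- `∫ D = 0`, so `z = 0`.
    have h := integral_norm_sq_mul_sub hV (conj z) ⟨k, hk⟩
    have hpt : ∀ ω, ‖1 + conj z * conj (char k ω)‖ ^ 2 * D ω =
        (1 + ‖z‖ ^ 2) * D ω + 2 * (conj z * ((D ω : ℂ) * conj (char k ω))).re := by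
      intro ω
      have h1 : ‖1 + conj z * conj (char k ω)‖ ^ 2 =
          1 + ‖z‖ ^ 2 + 2 * (conj z * conj (char k ω)).re := by
        rw [← Complex.normSq_eq_norm_sq, Complex.normSq_add, Complex.normSq_one, map_mul,
          one_mul, Complex.conj_re, Complex.normSq_conj, Complex.normSq_conj,
          Complex.normSq_eq_norm_sq, Complex.normSq_eq_norm_sq, norm_char]
        ring
      rw [h1, mul_left_comm, Complex.re_ofReal_mul]
      ring
    have hi2 : Integrable (fun ω => conj z * ((D ω : ℂ) * conj (char k ω))) (unitHaar p) :=
      (integrable_mul_conj_char hDi.ofReal k).const_mul _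
    change ∫ ω, ‖1 + conj z * conj (char k ω)‖ ^ 2 * D ω ∂(unitHaar p) = 0 at h
    simp only [hpt] at h
    have hre : ∫ ω, (conj z * ((D ω : ℂ) * conj (char k ω))).re ∂(unitHaar p) =
        (∫ ω, conj z * ((D ω : ℂ) * conj (char k ω)) ∂(unitHaar p)).re := integral_re hi2
    have hire : Integrable (fun ω => (conj z * ((D ω : ℂ) * conj (char k ω))).re) (unitHaar p) :=
      hi2.re
    rw [integral_add (hDi.const_mul _) (hire.const_mul 2), integral_const_mul,
      integral_const_mul, hD0, mul_zero, zero_add, hre, integral_const_mul] at h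
    have h2 : (conj z * z).re = 0 := (mul_eq_zero.1 h).resolve_left two_ne_zero
    rw [Complex.conj_mul', ← Complex.ofReal_pow, Complex.ofReal_re] at h2
    simpa using h2
  filter_upwards [ae_eq_zero_of_coeff_eq_zero hDi.ofReal hcoeff,
    periodization_ne_top_unit (fourier p φ)] with ω h1 h2
  have h3 : (periodization (fourier p φ) ω).toReal -
    (periodization (fourier p φ) ω).toReal ^ 2 = 0 :=
    Complex.ofReal_eq_zero.1 h1
  rcases mul_eq_zero.1 (show (periodization (fourier p φ) ω).toReal *
    (1 - (periodization (fourier p φ) ω).toReal) = 0 by linarith) with h4 | h4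
  · exact Or.inl (((ENNReal.toReal_eq_zero_iff _).1 h4).resolve_right h2)
  · exact Or.inr ((ENNReal.toReal_eq_one_iff _).1 (by linarith))

theorem periodization_le_one (hV : IsParsevalFMRA V φ) :
    ∀ᵐ ω ∂(haar p), periodization (fourier p φ) ω ≤ 1 := by
  filter_upwards [periodization_eq_zero_or_one hV] with ω hω
  rcases hω with h | h <;> simp [h]

theorem norm_fourier_le_one (hV : IsParsevalFMRA V φ) :
    ∀ᵐ ω ∂(haar p), ‖fourier p φ ω‖ₑ ≤ 1 := by
  filter_upwards [periodization_le_one hV] with ω hω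
  rw [periodization_eq] at hω
  have h := (ENNReal.le_tsum (f := fun h : H p => ‖fourier p φ (ω + h)‖ₑ ^ 2) 0).trans hω
  exact ENNReal.le_one_of_sq_le_one (by simpa using h)

theorem memLp_comp_dilation_symm (f : L2 p) :
    MemLp (fun x => f ((dilation p).symm x)) 2 (haar p) := by
  refine memLp_two_of_lintegral_ne_top
    ((Lp.memLp f).1.comp_quasiMeasurePreserving quasiMeasurePreserving_dilation_symm) fun htop => ?_
  have h := lintegral_comp_dilation (p := p) fun x => ‖f ((dilation p).symm x)‖ₑ ^ 2
  simp only [AddEquiv.symm_apply_apply, htop, ENNReal.mul_top scale_ne_zero] at h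
  exact lintegral_enorm_sq_ne_top (Lp.memLp f) h

/-- The class of `f (A⁻¹ ·)` in `L²`. -/
def contract (f : L2 p) : L2 p := (memLp_comp_dilation_symm f).toLp

theorem coeFn_contract (f : L2 p) :
    contract f =ᵐ[haar p] fun x => f ((dilation p).symm x) :=
  (memLp_comp_dilation_symm f).coeFn_toLp

theorem contract_comp_dilation (f : L2 p) :
    f =ᵐ[haar p] fun x => contract f (dilation p x) := by
  filter_upwards [quasiMeasurePreserving_dilation.ae (coeFn_contract f)] with x hx
  rw [hx, AddEquiv.symm_apply_apply]

theorem contract_mem (hV : IsFMRA V φ) {j : ℤ} {f : L2 p} (hf : f ∈ V (j + 1)) :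
    contract f ∈ V j :=
  (hV.dilate j _ f (contract_comp_dilation f)).2 hf

theorem contract_sub (f g : L2 p) : contract (f - g) = contract f - contract g := by
  rw [contract, contract, contract, ← MemLp.toLp_sub]
  refine (MemLp.toLp_eq_toLp_iff _ _).2 ?_
  filter_upwards [quasiMeasurePreserving_dilation_symm.ae (Lp.coeFn_sub f g)] with x hx
  rw [hx, Pi.sub_apply, Pi.sub_apply]

theorem scale_mul_enorm_contract_sq (f : L2 p) : scale p * ‖contract f‖ₑ ^ 2 = ‖f‖ₑ ^ 2 := by
  rw [enorm_sq_eq_lintegral, enorm_sq_eq_lintegral,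
    ← lintegral_comp_dilation fun x => ‖contract f x‖ₑ ^ 2]
  exact lintegral_congr_ae ((contract_comp_dilation f).mono fun x hx => by simp only [← hx])

/-- The element of `V_0` whose Fourier transform is `φ̂ (B ·)`. -/
theorem exists_mem_fourier_eq_comp_dilation (hV : IsParsevalFMRA V φ) :
    ∃ f ∈ V 0, fourier p f =ᵐ[haar p] fun ω => fourier p φ (dilation p ω) := by
  -- The inclusion `V (-1) ≤ V 0` enters here.
  have hmem : contract φ ∈ V 0 := hV.mono (-1) (contract_mem hV.toIsFMRA (j := -1) hV.mem)
  refine ⟨((scale p).toReal : ℂ) • contract φ, (V 0).smul_mem _ hmem, ?_⟩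
  rw [map_smul]
  filter_upwards [Lp.coeFn_smul ((scale p).toReal : ℂ) (fourier p (contract φ)),
    fourier_comp_dilation (contract_comp_dilation φ)] with ω h1 h2
  rw [h1, h2]
  simp

omit [NeZero p] in
theorem dilation_mem_H {h : VilenkinGroup p} (hh : h ∈ H p) : dilation p h ∈ H p :=
  fun j hj => hh (j + 1) (by omega)

/-- The dilation maps `H` injectively into itself, so the left side is a partial sum of the right
side. -/
theorem periodization_comp_dilation_le (g : VilenkinGroup p → ℂ) (ω : VilenkinGroup p) :
    periodization (fun η => g (dilation p η)) ω ≤ periodization g (dilation p ω) := by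
  rw [periodization_eq, periodization_eq]
  simp only [map_add]
  exact ENNReal.tsum_comp_le_tsum_of_injective
    (f := fun h : H p => (⟨dilation p h, dilation_mem_H h.2⟩ : H p))
    (fun a b hab => Subtype.ext ((dilation p).injective (congrArg Subtype.val hab)))
    fun h => ‖g (dilation p ω + h)‖ₑ ^ 2

/-- Pythagoras on each coset, integrated over `U_0`, has the same total as the bracket term alone by
the frame identity; the nonnegative remainder therefore vanishes. -/
theorem ae_of_mem_V_zero (hV : IsParsevalFMRA V φ) {f : L2 p} (hf : f ∈ V 0) :
    ∀ᵐ ω ∂(haar p), fourier p f ω =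
      bracket (fourier p f) (fourier p φ) ω * fourier p φ ω := by
  set F := fourier p f with hF
  set Φ := fourier p φ with hΦ
  -- Quantifying over all translates makes the statement `H`-periodic, so it can be checked on
  -- `U_0`.
  suffices h : ∀ᵐ ω ∂(haar p), ∀ k : H p, F (ω + k) = bracket F Φ ω * Φ (ω + k) by
    filter_upwards [h] with ω hω
    simpa using hω 0
  refine ae_of_ae_unitHaar (fun ω h hω k => ?_) ?_
  · rw [bracket_add, add_assoc]
    exact hω (h + k)
  have hbm := aestronglyMeasurable_bracket F Φ
  have hsum : ∀ᵐ ω ∂(unitHaar p), ∑' k : H p, ‖F (ω + k) - bracket F Φ ω * Φ (ω + k)‖ₑ ^ 2 +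
      ‖bracket F Φ ω‖ₑ ^ 2 = periodization F ω := by
    filter_upwards [periodization_ne_top_unit F,
      ae_unitHaar_of_ae (periodization_eq_zero_or_one hV)] with ω h1 h2
    rw [periodization_eq] at h1 h2 ⊢
    exact tsum_enorm_sub_sq_add h1 h2
  have hm : AEMeasurable (fun ω => ∑' k : H p, ‖F (ω + k) - bracket F Φ ω * Φ (ω + k)‖ₑ ^ 2)
      (unitHaar p) := by
    refine AEMeasurable.tsum fun k => AEMeasurable.pow_const (AEMeasurable.enorm ?_) 2
    exact ((measurable_coe_L2 F).comp (measurable_add_const _)).aemeasurable.sub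
      (hbm.aemeasurable.mul ((measurable_coe_L2 Φ).comp (measurable_add_const _)).aemeasurable)
  have hint := lintegral_congr_ae hsum
  rw [lintegral_add_left' hm, ← lintegral_bracket_of_mem hV hf] at hint
  have hfin : ∫⁻ ω, ‖bracket F Φ ω‖ₑ ^ 2 ∂(unitHaar p) ≠ ∞ := by
    rw [lintegral_bracket_of_mem hV hf, lintegral_periodization]
    exact ENNReal.pow_ne_top enorm_ne_top
  have hzero : ∫⁻ ω, ∑' k : H p, ‖F (ω + k) - bracket F Φ ω * Φ (ω + k)‖ₑ ^ 2 ∂(unitHaar p) = 0 :=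
    (ENNReal.add_left_inj hfin).1 (hint.trans (zero_add _).symm)
  filter_upwards [(lintegral_eq_zero_iff' hm).1 hzero] with ω hω k
  have := ENNReal.tsum_eq_zero.1 hω k
  simpa [sub_eq_zero] using this

/-- The refinement equation in the Fourier domain, with a mask bounded by `1`. -/
theorem exists_mask (hV : IsParsevalFMRA V φ) : ∃ m : VilenkinGroup p → ℂ,
    (∀ ω, ∀ h ∈ H p, m (ω + h) = m ω) ∧ AEStronglyMeasurable m (unitHaar p) ∧
      (∀ᵐ ω ∂(haar p), ‖m ω‖ₑ ≤ 1) ∧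
      ∀ᵐ ω ∂(haar p), fourier p φ (dilation p ω) = m ω * fourier p φ ω := by
  obtain ⟨f, hf, hfφ⟩ := exists_mem_fourier_eq_comp_dilation hV
  refine ⟨bracket (fourier p f) (fourier p φ), fun ω h hh => bracket_add _ _ ω ⟨h, hh⟩,
    aestronglyMeasurable_bracket _ _, ?_, ?_⟩
  · filter_upwards [ae_forall_add hfφ, periodization_le_one hV,
      quasiMeasurePreserving_dilation.ae (periodization_le_one hV)] with ω h1 h2 h3
    have h4 : periodization (fourier p f) ω ≤ 1 := by
      refine le_trans (le_of_eq ?_) ((periodization_comp_dilation_le (fourier p φ) ω).trans h3)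
      simp only [periodization_eq, h1]
    rw [periodization_eq] at h2 h4
    -- Cauchy–Schwarz bounds `|m(ω)|²` by the product of two periodizations, at most `P(B ω)` and
    -- `P(ω)`.
    have h5 := enorm_tsum_mul_conj_sq_le (ne_top_of_le_ne_top ENNReal.one_ne_top h4)
      (ne_top_of_le_ne_top ENNReal.one_ne_top h2)
    have h6 : ‖bracket (fourier p f) (fourier p φ) ω‖ₑ ^ 2 ≤ 1 :=
      h5.trans (mul_le_one' h4 h2)
    exact ENNReal.le_one_of_sq_le_one h6
  · filter_upwards [hfφ, ae_of_mem_V_zero hV hf] with ω h1 h2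
    rw [← h1, h2]

end VilenkinGroup

/-! ### The limit along contractions -/

namespace VilenkinGroup

variable {p : ℕ} [NeZero p] {V : ℤ → Submodule ℂ (L2 p)} {φ : L2 p}

theorem scale_pow_mul_haar_U (n : ℕ) : scale p ^ n * haar p (U p (-(n : ℤ))) = 1 := by
  induction n with
  | zero => simp [haar_U_zero]
  | succ n ih =>
    rw [← ih, pow_succ, mul_assoc]
    congr 1
    have h := lintegral_comp_dilation (p := p) ((U p (-((n + 1 : ℕ) : ℤ))).indicator 1)
    have hp : (fun x => (U p (-((n + 1 : ℕ) : ℤ))).indicator (1 : VilenkinGroup p → ℝ≥0∞)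
        (dilation p x)) = (U p (-(n : ℤ))).indicator 1 := by
      funext x
      refine Set.indicator_eq_indicator ?_ rfl
      rw [dilation_mem_U]
      simp
    rw [hp, lintegral_indicator_one (measurableSet_U _),
      lintegral_indicator_one (measurableSet_U _)] at h
    exact h.symm

theorem setLIntegral_U (f : VilenkinGroup p → ℝ≥0∞) (n : ℕ) :
    ∫⁻ ω in U p n, f ω ∂(haar p) =
      scale p ^ n * ∫⁻ ω, f ((dilation p).symm^[n] ω) ∂(unitHaar p) := by
  induction n generalizing f with
  | zero => simp [unitHaar]
  | succ n ih =>
    have h := lintegral_comp_dilation (p := p)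
      ((U p n).indicator fun ω => f ((dilation p).symm ω))
    have hp : (fun x => (U p n).indicator (fun ω => f ((dilation p).symm ω)) (dilation p x)) =
        (U p ((n + 1 : ℕ) : ℤ)).indicator f := by
      funext x
      refine Set.indicator_eq_indicator ?_ (congrArg f ((dilation p).symm_apply_apply x))
      rw [dilation_mem_U]
      simp
    rw [hp, lintegral_indicator (measurableSet_U _), lintegral_indicator (measurableSet_U _),
      ih] at h
    rw [h, pow_succ', mul_assoc]
    simp only [Function.iterate_succ_apply']

theorem contract_indicatorU (n : ℕ) : contract (indicatorU p n) = indicatorU p (n + 1) := by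
  refine Lp.ext ?_
  filter_upwards [coeFn_contract (indicatorU p n), coeFn_indicatorU (p := p) (n + 1),
    quasiMeasurePreserving_dilation_symm.ae (coeFn_indicatorU (p := p) n)] with x h1 h2 h3
  rw [h1, h2, h3]
  refine Set.indicator_eq_indicator ?_ rfl
  rw [← dilation_symm_mem_U (l := -((n + 1 : ℕ) : ℤ))]
  simp

/-- Contracting `i` times carries `V i` to `V 0` and the indicator of `U_{-n}` to that of
`U_{-(n+i)}`, dividing squared distances by `scale p ^ i`. -/
theorem exists_mem_V_zero_approx (hV : IsFMRA V φ) (i : ℕ) : ∀ n : ℕ, ∀ w ∈ V i, ∃ v ∈ V 0,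
    scale p ^ i * ‖indicatorU p (n + i) - v‖ₑ ^ 2 = ‖indicatorU p n - w‖ₑ ^ 2 := by
  induction i with
  | zero => exact fun n w hw => ⟨w, hw, by simp⟩
  | succ i ih =>
    intro n w hw
    obtain ⟨v, hv, h⟩ := ih (n + 1) (contract w) (contract_mem hV (by exact_mod_cast hw))
    refine ⟨v, hv, ?_⟩
    rw [pow_succ', mul_assoc, ← add_assoc, add_right_comm, h, ← contract_indicatorU,
      ← contract_sub, scale_mul_enorm_contract_sq]

theorem enorm_indicatorU_sq (n : ℕ) : ‖indicatorU p n‖ₑ ^ 2 = haar p (U p (-(n : ℤ))) := by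
  rw [enorm_sq_eq_lintegral, ← lintegral_indicator_one (measurableSet_U _)]
  refine lintegral_congr_ae ?_
  filter_upwards [coeFn_indicatorU (p := p) n] with x hx
  rw [hx]
  by_cases h : x ∈ U p (-(n : ℤ))
  · simp [Set.indicator_of_mem h]
  · simp [Set.indicator_of_notMem h]

/-- The transform is `M` times the indicator of `U_n ⊆ U_0`, so over `U_0` only the term `h = 0` of
the bracket survives. Rescaling `U_n` to `U_0` gives `M² scale p ^ n`, which equals `M`. -/
theorem lintegral_bracket_indicatorU (φ : L2 p) (n : ℕ) :
    ∫⁻ ω, ‖bracket (fourier p (indicatorU p n)) (fourier p φ) ω‖ₑ ^ 2 ∂(unitHaar p) =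
      haar p (U p (-(n : ℤ))) *
        ∫⁻ ω, ‖fourier p φ ((dilation p).symm^[n] ω)‖ₑ ^ 2 ∂(unitHaar p) := by
  set M := haar p (U p (-(n : ℤ))) with hM
  have hMtop : M ≠ ∞ := (haar_U_neg_lt_top n).ne
  have hb : ∀ᵐ ω ∂(unitHaar p), ‖bracket (fourier p (indicatorU p n)) (fourier p φ) ω‖ₑ ^ 2 =
      (U p n).indicator (fun ω => M ^ 2 * ‖fourier p φ ω‖ₑ ^ 2) ω := by
    filter_upwards [ae_unitHaar_mem, ae_unitHaar_of_ae (ae_forall_add (fourier_indicatorU n))]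
      with ω h1 h2
    rw [bracket, tsum_eq_single 0]
    · rw [h2, AddSubgroup.coe_zero, add_zero]
      by_cases hω : ω ∈ U p n
      · rw [Set.indicator_of_mem hω, Set.indicator_of_mem hω, enorm_mul, RCLike.enorm_conj, mul_pow,
          ← ofReal_norm (((haar p).real _ : ℝ) : ℂ), Complex.norm_real,
          Real.norm_of_nonneg measureReal_nonneg, ofReal_measureReal hMtop]
      · rw [Set.indicator_of_notMem hω, Set.indicator_of_notMem hω]
        simp
    · intro k hk
      rw [h2, Set.indicator_of_notMem, zero_mul]
      intro hU
      refine hk (Subtype.ext (eq_zero_of_mem_H_of_mem_U k.2 ?_))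
      have := U_anti (by omega : (0 : ℤ) ≤ n) hU
      rw [add_comm, add_mem_U_iff h1] at this
      exact this
  have hsub : U p n ∩ U p 0 = U p n := Set.inter_eq_left.2 (U_anti (by omega))
  rw [lintegral_congr_ae hb, lintegral_indicator (measurableSet_U _), unitHaar,
    Measure.restrict_restrict (measurableSet_U _), hsub,
    lintegral_const_mul' _ _ (ENNReal.pow_ne_top hMtop),
    setLIntegral_U (fun ω => ‖fourier p φ ω‖ₑ ^ 2) n, ← mul_assoc, sq, mul_assoc M, mul_comm M (_ ^ n),
    hM, scale_pow_mul_haar_U, mul_one]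
  rfl

/-- The lower estimate of the analysis operator through the distance to `V_0`. -/
theorem enorm_sq_le_lintegral_bracket_add (hV : IsParsevalFMRA V φ) (u : L2 p) {v : L2 p}
    (hv : v ∈ V 0) :
    ‖u‖ₑ ^ 2 ≤ ∫⁻ ω, ‖bracket (fourier p u) (fourier p φ) ω‖ₑ ^ 2 ∂(unitHaar p) +
      ‖u - v‖ₑ ^ 2 := by
  have : CompleteSpace (V 0) := (hV.closed 0).completeSpace_coe
  -- The translates lie in `V 0`, so their inner products with `u` only see its projection `q`, and
  -- no `v ∈ V 0` is closer to `u` than `q`.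
  set q : L2 p := (V 0).starProjection u with hq
  have hqV : q ∈ V 0 := Submodule.starProjection_apply_mem _ _
  have horth : ∀ w ∈ V 0, inner ℂ (u - q) w = 0 := fun w hw =>
    Submodule.starProjection_inner_eq_zero u w hw
  have h1 : ∑' h : H p, ‖inner ℂ u (translate (h : VilenkinGroup p) φ)‖ₑ ^ 2 = ‖q‖ₑ ^ 2 := by
    rw [← tsum_enorm_inner_of_mem hV hqV]
    refine tsum_congr fun h => ?_
    have := horth _ (translate_mem hV h)
    rw [inner_sub_left, sub_eq_zero] at this
    rw [this]
  rw [← tsum_enorm_inner_translate, h1]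
  have e1 : ‖u‖ ^ 2 = ‖q‖ ^ 2 + ‖u - q‖ ^ 2 := by
    have := norm_add_sq_eq_norm_sq_add_norm_sq_of_inner_eq_zero (u - q) q (horth q hqV)
    rw [sub_add_cancel] at this
    linarith
  have e2 : ‖u - v‖ ^ 2 = ‖u - q‖ ^ 2 + ‖q - v‖ ^ 2 := by
    have := norm_add_sq_eq_norm_sq_add_norm_sq_of_inner_eq_zero (u - q) (q - v)
      (horth _ ((V 0).sub_mem hqV hv))
    rw [sub_add_sub_cancel] at this
    linarith
  have e3 : ‖u‖ ^ 2 ≤ ‖q‖ ^ 2 + ‖u - v‖ ^ 2 := by nlinarith [sq_nonneg ‖q - v‖]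
  simp only [← ofReal_norm, ← ENNReal.ofReal_pow (norm_nonneg _)]
  rw [← ENNReal.ofReal_add (sq_nonneg _) (sq_nonneg _)]
  exact ENNReal.ofReal_le_ofReal e3

theorem exists_one_le_lintegral_add (hV : IsParsevalFMRA V φ) {ε : ℝ} (hε : 0 < ε) : ∃ n : ℕ,
    1 ≤ ∫⁻ ω, ‖fourier p φ ((dilation p).symm^[n] ω)‖ₑ ^ 2 ∂(unitHaar p) +
      ENNReal.ofReal ε ^ 2 := by
  have hd : indicatorU p 0 ∈ closure (⋃ j, (V j : Set (L2 p))) := by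
    rw [hV.dense]
    exact Set.mem_univ _
  obtain ⟨w, hw, hdist⟩ := Metric.mem_closure_iff.1 hd ε hε
  obtain ⟨j, hj⟩ := Set.mem_iUnion.1 hw
  have hmono : Monotone V := monotone_int_of_le_succ hV.mono
  have hwn : w ∈ V (j.toNat : ℤ) := hmono (Int.self_le_toNat j) hj
  obtain ⟨v, hv, hvw⟩ := exists_mem_V_zero_approx hV.toIsFMRA j.toNat 0 w hwn
  refine ⟨j.toNat, ?_⟩
  have h := enorm_sq_le_lintegral_bracket_add hV (indicatorU p (0 + j.toNat)) hv
  -- Multiplying by `scale p ^ n` normalizes the squared norm of the indicator of `U_{-n}` to 1 and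
  -- restores the original distance to `w`.
  have h2 := mul_le_mul_right h (scale p ^ j.toNat)
  rw [mul_add, hvw, zero_add, enorm_indicatorU_sq, lintegral_bracket_indicatorU, ← mul_assoc,
    scale_pow_mul_haar_U, one_mul] at h2
  refine h2.trans ?_
  gcongr
  rw [← ofReal_norm, ← dist_eq_norm]
  exact ENNReal.ofReal_le_ofReal hdist.le

theorem ae_dilation_symm_iterate {Q : VilenkinGroup p → Prop} (hQ : ∀ᵐ ω ∂(haar p), Q ω) :
    ∀ᵐ ω ∂(haar p), ∀ n : ℕ, Q ((dilation p).symm^[n] ω) :=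
  ae_all_iff.2 fun n => (quasiMeasurePreserving_dilation_symm.iterate n).ae hQ

/-- The refinement equation at `B⁻ⁿ⁻¹ ω` gives `φ̂(B⁻ⁿ ω) = m(B⁻ⁿ⁻¹ ω) φ̂(B⁻ⁿ⁻¹ ω)`, and `|m| ≤ 1`.
-/
theorem ae_monotone_enorm_fourier (hV : IsParsevalFMRA V φ) : ∀ᵐ ω ∂(haar p),
    Monotone fun n : ℕ => ‖fourier p φ ((dilation p).symm^[n] ω)‖ₑ ^ 2 := by
  obtain ⟨m, -, -, hm1, hm⟩ := exists_mask hV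
  filter_upwards [ae_dilation_symm_iterate hm1, ae_dilation_symm_iterate hm] with ω h1 h2
  refine monotone_nat_of_le_succ fun n => ?_
  have h3 := h2 (n + 1)
  rw [Function.iterate_succ_apply', AddEquiv.apply_symm_apply,
    ← Function.iterate_succ_apply' (dilation p).symm] at h3
  rw [h3, enorm_mul]
  gcongr
  exact mul_le_of_le_one_left' (h1 (n + 1))

theorem ae_unitHaar_tendsto (hV : IsParsevalFMRA V φ) : ∀ᵐ ω ∂(unitHaar p),
    Tendsto (fun n : ℕ => ‖fourier p φ ((dilation p).symm^[n] ω)‖) atTop (𝓝 1) := by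
  set s : VilenkinGroup p → ℝ≥0∞ :=
    fun ω => ⨆ n : ℕ, ‖fourier p φ ((dilation p).symm^[n] ω)‖ₑ ^ 2 with hs
  have hs1 : s ≤ᵐ[unitHaar p] fun _ => 1 := by
    filter_upwards [ae_unitHaar_of_ae (ae_dilation_symm_iterate (norm_fourier_le_one hV))] with ω h
    exact iSup_le fun n => pow_le_one' (h n) 2
  have hint : 1 ≤ ∫⁻ ω, s ω ∂(unitHaar p) := by
    have hle : ∀ k : ℕ, 1 ≤ ∫⁻ ω, s ω ∂(unitHaar p) + ENNReal.ofReal (1 / (k + 1)) ^ 2 := by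
      intro k
      obtain ⟨n, hn⟩ := exists_one_le_lintegral_add hV (Nat.one_div_pos_of_nat (α := ℝ) (n := k))
      refine hn.trans ?_
      gcongr with ω
      exact le_iSup (fun n : ℕ => ‖fourier p φ ((dilation p).symm^[n] ω)‖ₑ ^ 2) n
    have hlim : Tendsto (fun k : ℕ => ∫⁻ ω, s ω ∂(unitHaar p) + ENNReal.ofReal (1 / (k + 1)) ^ 2)
        atTop (𝓝 (∫⁻ ω, s ω ∂(unitHaar p) + ENNReal.ofReal 0 ^ 2)) :=
      tendsto_const_nhds.add
        (ENNReal.Tendsto.pow (ENNReal.tendsto_ofReal tendsto_one_div_add_atTop_nhds_zero_nat))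
    have := ge_of_tendsto' hlim hle
    simpa using this
  have hsmeas : AEMeasurable (fun _ : VilenkinGroup p => (1 : ℝ≥0∞)) (unitHaar p) :=
    aemeasurable_const
  -- A function that is at most 1 on a probability space and has integral at least 1 equals 1 a.e.
  have heq : s =ᵐ[unitHaar p] fun _ => 1 := by
    refine ae_eq_of_ae_le_of_lintegral_le hs1 ?_ hsmeas ?_
    · refine ne_top_of_le_ne_top ENNReal.one_ne_top ((lintegral_mono_ae hs1).trans ?_)
      simp
    · simpa using hint
  filter_upwards [heq, ae_unitHaar_of_ae (ae_monotone_enorm_fourier hV)] with ω h1 h2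
  have h3 := tendsto_atTop_iSup h2
  rw [show (⨆ n : ℕ, ‖fourier p φ ((dilation p).symm^[n] ω)‖ₑ ^ 2) = 1 from h1] at h3
  have h4 := ((ENNReal.tendsto_toReal ENNReal.one_ne_top).comp h3).sqrt
  simpa [Function.comp_def] using h4

theorem ae_tendsto_norm_fourier (hV : IsParsevalFMRA V φ) : ∀ᵐ ω ∂(haar p),
    Tendsto (fun n : ℕ => ‖fourier p φ ((dilation p).symm^[n] ω)‖) atTop (𝓝 1) := by
  have h := (ae_restrict_iff' (measurableSet_U 0)).1 (ae_unitHaar_tendsto hV)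
  filter_upwards [ae_dilation_symm_iterate h] with ω hω
  -- Some `B⁻ⁿ ω` lies in `U_0`, and the limit does not change when the sequence is shifted by `n`.
  obtain ⟨n, hn⟩ := exists_mem_U ω
  have hn' : (dilation p).symm^[n] ω ∈ U p 0 := by
    have := (dilation_symm_iterate_mem_U n).2 hn
    rwa [neg_add_cancel] at this
  have := hω n hn'
  simp only [← Function.iterate_add_apply] at this
  exact (tendsto_add_atTop_iff_nat n).1 this

end VilenkinGroup

end

open VilenkinGroup in
theorem mainTheorem3 (p : ℕ) [NeZero p] (hp : 2 ≤ p)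
    (V : ℤ → Submodule ℂ (L2 p)) (φ : L2 p) (hV : IsParsevalFMRA V φ) :
    (∃ φhat : L2 p, IsFourierTransform φ φhat) ∧
    ∀ φhat : L2 p, IsFourierTransform φ φhat →
      (∀ᵐ ω ∂(haar p),
        ∑' h : Hperp p, ‖φhat (ω + h)‖ₑ ^ 2 =
          (periodizationSupport φhat).indicator (fun _ => 1) ω) ∧
      (∃ m : VilenkinGroup p → ℂ,
        (∀ ω, ∀ h ∈ Hperp p, m (ω + h) = m ω) ∧
        MemLp m 2 ((haar p).restrict (U p 0)) ∧
        ∀ᵐ ω ∂(haar p), φhat (dilation p ω) = m ω * φhat ω) ∧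
      (∀ᵐ ω ∂(haar p),
        Tendsto (fun j : ℕ => ‖φhat ((dilation p).symm^[j] ω)‖) atTop (𝓝 1)) := by
  refine ⟨⟨_, isFourierTransform_fourier φ⟩, fun φhat hφ => ?_⟩
  obtain rfl := (isFourierTransform_fourier φ).unique hφ
  refine ⟨?_, ?_, ae_tendsto_norm_fourier hV⟩
  · filter_upwards [periodization_eq_zero_or_one hV] with ω hω
    change periodization (fourier p φ) ω = _
    rcases hω with h | h
    · rw [Set.indicator_of_notMem, h]
      exact fun hne => hne h
    · rw [Set.indicator_of_mem, h]
      exact fun h0 => one_ne_zero (h.symm.trans h0)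
  · obtain ⟨m, hper, hmeas, hbd, hm⟩ := exists_mask hV
    refine ⟨m, fun ω h hh => hper ω h ?_, ?_, hm⟩
    · rwa [← coe_H_eq_Hperp] at hh
    -- A mask bounded by 1 is square integrable because `U_0` has finite measure.
    · refine MemLp.of_bound (μ := unitHaar p) hmeas 1 ((ae_unitHaar_of_ae hbd).mono fun ω hω => ?_)
      have := ENNReal.toReal_mono ENNReal.one_ne_top hω
      simpa using this
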